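/- A tournament on $[n]$ is a loopless digraph with exactly one directed edge between any two distinct vertices. It is presented as a stream that lists each of its edges exactly once, in an arbitrary (adversarial) order; a $p$-pass algorithm reads this stream $p$ times in the same order. Space is measured in bits: an algorithm that uses $s$ bits of space has at most $2^s$ memory contents, and its output is determined by the final memory contents (and, for a randomized algorithm, its coin tosses). A randomized algorithm solves a problem if, for every tournament and every order of its edges, its output is wrong with probability at most $1/3$. For a digraph $G$ on $n$ vertices let $\beta_G$ be the minimum, over all orderings $\sigma$ of the vertices, of the number of edges $(v,u)$ of $G$ with $\sigma(u)<\sigma(v)$ (the size of a minimum feedback arc set). 1. Deciding whether a tournament on $n$ vertices is acyclic is possible, deterministically, in one pass and $O(n\log n)$ space ($n\ge 2$). This holds in the above (non-uniform) model, and also for a single random access machine program that works for all $n$, where all of the working memory is counted (number of memory cells times number of bits per cell). 2. There are constants $c>0$ and $n_0$ such that, for all $n\ge n_0$ and $p\ge1$, every randomized (in particular, every deterministic) $p$-pass algorithm that decides whether a tournament on $n$ vertices is acyclic uses at least $c\,n/p$ bits of space. 3. There are constants $c>0$ and $n_0$ such that, for all $n\ge n_0$, $p\ge1$ and all real $\alpha\ge1$,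 every randomized (in particular, every deterministic) $p$-pass algorithm that, given a tournament $G$ on $n$ vertices, outputs an integer $\hat\beta\in[\beta_G,\alpha\beta_G]$ uses at least $c\,n/p$ bits of space. -/

import Mathlib

universe u

namespace TournamentStream

/-! ### Digraphs and the quantities attached to them -/

/-- A tournament: no loops, and exactly one directed edge between any two distinct vertices. -/
def IsTournament {V : Type*} (G : Digraph V) : Prop :=
  (∀ v, ¬ G.Adj v v) ∧ ∀ v w, v ≠ w → Xor (G.Adj v w) (G.Adj w v)

/-- A digraph is acyclic if no vertex can be reached from itself by a directed walk of
positive length. -/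
def IsAcyclic {V : Type*} (G : Digraph V) : Prop :=
  ∀ v, ¬ Relation.TransGen G.Adj v v

/-- The back edges of `G` with respect to the ordering that puts the vertex `v` at
position `σ v`. -/
def backEdges {n : ℕ} (G : Digraph (Fin n)) (σ : Equiv.Perm (Fin n)) : Set (Fin n × Fin n) :=
  {e | G.Adj e.1 e.2 ∧ σ e.2 < σ e.1}

/-- The size of a minimum feedback arc set: the least number of back edges of an ordering. -/
noncomputable def fasSize {n : ℕ} (G : Digraph (Fin n)) : ℕ :=
  ⨅ σ : Equiv.Perm (Fin n), (backEdges G σ).ncard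

/-- The list `l` presents `G` as a stream: it lists every edge of `G` exactly once, in an
arbitrary order. -/
def IsStreamOf {n : ℕ} (G : Digraph (Fin n)) (l : List (Fin n × Fin n)) : Prop :=
  l.Nodup ∧ ∀ e, e ∈ l ↔ G.Adj e.1 e.2

/-! ### The problems: `Q G b` says that `b` is a correct output on the input `G` -/

/-- Deciding acyclicity. -/
def acyc {n : ℕ} (G : Digraph (Fin n)) (b : Bool) : Prop :=
  b = true ↔ IsAcyclic G

/-- `α`-approximation of the size of a minimum feedback arc set. -/
def fasSizeApprox (α : ℝ) {n : ℕ} (G : Digraph (Fin n)) (b : ℤ) : Prop :=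
  (fasSize G : ℝ) ≤ b ∧ (b : ℝ) ≤ α * fasSize G

/-! ### Multi-pass streaming algorithms with `s` bits of memory -/

/-- A deterministic streaming algorithm with tokens in `τ`, outputs in `β` and `s` bits of memory,
i.e. with memory contents in a set of size `2 ^ s`.
The memory is updated at each token; the update may depend on the number of the current
pass and on the position of the token in the stream (so that, once the coin tosses of a randomized
algorithm are fixed, fresh tosses made at each token are covered). The output is determined by
the contents of the memory at the end of the last pass. -/
structure StreamAlg (τ β : Type*) (s : ℕ) where
  /-- the initial contents of the memory -/
  init : Fin (2 ^ s)
  /-- `step k i m e` is the new memory when the token `e` is read at position `i` of pass `k`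
  with memory `m` -/
  step : ℕ → ℕ → Fin (2 ^ s) → τ → Fin (2 ^ s)
  /-- the output as a function of the final memory -/
  output : Fin (2 ^ s) → β

namespace StreamAlg

variable {τ β : Type*} {s : ℕ}

/-- Read the tokens of a list in pass `k`, the first of them being at position `i`. -/
def readFrom (A : StreamAlg τ β s) (k : ℕ) : ℕ → List τ → Fin (2 ^ s) → Fin (2 ^ s)
  | _, [], m => m
  | i, e :: l, m => A.readFrom k (i + 1) l (A.step k i m e)

/-- The memory after `p` passes over the stream `l`. -/
def memAfter (A : StreamAlg τ β s) (l : List τ) : ℕ → Fin (2 ^ s)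
  | 0 => A.init
  | k + 1 => A.readFrom k 0 l (A.memAfter l k)

/-- The output after `p` passes over the stream `l`. -/
def run (A : StreamAlg τ β s) (p : ℕ) (l : List τ) : β :=
  A.output (A.memAfter l p)

end StreamAlg

/-- `A` solves the problem `Q` on `n`-vertex tournaments in `p` passes, deterministically. -/
def Solves {n : ℕ} {β : Type*} {s : ℕ} (Q : Digraph (Fin n) → β → Prop) (p : ℕ)
    (A : StreamAlg (Fin n × Fin n) β s) : Prop :=
  ∀ G : Digraph (Fin n), IsTournament G → ∀ l, IsStreamOf G l → Q G (A.run p l)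

/-- A randomized algorithm is a deterministic algorithm `A ω` chosen according to the random
outcome `ω` of a probability space. It solves `Q` on `n`-vertex tournaments in `p` passes if, for
each tournament and each order of its edges, it errs with probability at most `1/3`. -/
def RandSolves {n : ℕ} {β : Type*} {s : ℕ} (Q : Digraph (Fin n) → β → Prop) (p : ℕ)
    {Ω : Type u} [MeasurableSpace Ω] (μ : MeasureTheory.Measure Ω)
    (A : Ω → StreamAlg (Fin n × Fin n) β s) : Prop :=
  ∀ G : Digraph (Fin n), IsTournament G → ∀ l, IsStreamOf G l →
    μ {ω | ¬ Q G ((A ω).run p l)} ≤ 1 / 3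

/-! ### A uniform machine model for one-pass algorithms

A random access machine whose input is read once, token by token. All of its working memory,
also between two tokens and after the last one, is visible in its configurations. -/

/-- Instructions; `a`, `b`, `c` are addresses of memory cells and `t` is a program line. -/
inductive Instr where
  /-- `M[a] := k` -/
  | const (a k : ℕ)
  /-- `M[a] := M[b] + M[c]` -/
  | add (a b c : ℕ)
  /-- `M[a] := M[M[b]]` -/
  | load (a b : ℕ)
  /-- `M[M[a]] := M[b]` -/
  | store (a b : ℕ)
  /-- jump to line `t` if `M[a] = M[b]` -/
  | jumpEq (a b t : ℕ)
  /-- read the next token `(x, y)` of the stream, `M[a] := x` and `M[b] := y` in this order;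
  jump to line `t` if the stream is exhausted -/
  | next (a b t : ℕ)
  /-- stop, with the given answer -/
  | halt (answer : Bool)

/-- A configuration: the program line, the memory, and the part of the stream not yet read. -/
structure Config where
  line : ℕ
  mem : ℕ → ℕ
  rest : List (ℕ × ℕ)

/-- One step of the program `P`; nothing changes after the machine has stopped (by `halt` or
by leaving the program). -/
def step (P : List Instr) (c : Config) : Config :=
  match P[c.line]? with
  | none => c
  | some (.const a k) => ⟨c.line + 1, Function.update c.mem a k, c.rest⟩
  | some (.add a b d) => ⟨c.line + 1, Function.update c.mem a (c.mem b + c.mem d), c.rest⟩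
  | some (.load a b) => ⟨c.line + 1, Function.update c.mem a (c.mem (c.mem b)), c.rest⟩
  | some (.store a b) => ⟨c.line + 1, Function.update c.mem (c.mem a) (c.mem b), c.rest⟩
  | some (.jumpEq a b t) => ⟨if c.mem a = c.mem b then t else c.line + 1, c.mem, c.rest⟩
  | some (.next a b t) =>
    match c.rest with
    | [] => ⟨t, c.mem, []⟩
    | e :: l => ⟨c.line + 1, Function.update (Function.update c.mem a e.1) b e.2, l⟩
  | some (.halt _) => c

/-- The start of the machine on an `n`-vertex graph stream: cell `0` holds `n`, all other cells
hold `0`. -/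
def start {n : ℕ} (l : List (Fin n × Fin n)) : Config :=
  ⟨0, Function.update (fun _ => 0) 0 n, l.map fun e => (e.1.val, e.2.val)⟩

/-- The configuration after `t` steps. -/
def configAt (P : List Instr) {n : ℕ} (l : List (Fin n × Fin n)) (t : ℕ) : Config :=
  (step P)^[t] (start l)

/-- The program `P` stops on the stream `l` with the answer `b`. -/
def Answers (P : List Instr) {n : ℕ} (l : List (Fin n × Fin n)) (b : Bool) : Prop :=
  ∃ t, P[(configAt P l t).line]? = some (.halt b)

/-- Throughout its run on `l`, the program `P` uses only the first `m` memory cells,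
and never holds more than `w` bits in a cell: it works in `m * w` bits of memory. -/
def WorksIn (P : List Instr) {n : ℕ} (l : List (Fin n × Fin n)) (m w : ℕ) : Prop :=
  ∀ t, (∀ a, m ≤ a → (configAt P l t).mem a = 0) ∧ ∀ a, (configAt P l t).mem a < 2 ^ w

end TournamentStream

namespace TournamentStream

open Finset

section Tournaments

/-- The in-degree of a vertex. -/
noncomputable def inDeg {n : ℕ} (G : Digraph (Fin n)) (v : Fin n) : ℕ :=
  {w | G.Adj w v}.ncard

lemma isAcyclic_of_rank {V : Type*} {G : Digraph V} (r : V → ℕ)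
    (hr : ∀ u v, G.Adj u v → r u < r v) : IsAcyclic G := by
  have h : ∀ u v, Relation.TransGen G.Adj u v → r u < r v := by
    intro u v huv
    induction huv with
    | single h => exact hr _ _ h
    | tail _ h ih => exact ih.trans (hr _ _ h)
  exact fun v hv => (h v v hv).false

lemma IsTournament.trans_of_isAcyclic {V : Type*} {G : Digraph V} (hG : IsTournament G)
    (hA : IsAcyclic G) {u v w : V} (huv : G.Adj u v) (hvw : G.Adj v w) : G.Adj u w := by
  by_contra h
  have hne : u ≠ w := by
    rintro rfl
    exact hA u (.tail (.single huv) hvw)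
  rcases hG.2 u w hne with h' | h'
  · exact h h'.1
  · exact hA u (.tail (.tail (.single huv) hvw) h'.1)

variable {n : ℕ} {G : Digraph (Fin n)}

lemma IsTournament.inDeg_lt (hG : IsTournament G) (v : Fin n) : inDeg G v < n := by
  have h : {w | G.Adj w v} ⊂ Set.univ :=
    ⟨Set.subset_univ _, fun h => hG.1 v (h (Set.mem_univ v))⟩
  have := Set.ncard_lt_ncard h (Set.toFinite _)
  rwa [Set.ncard_univ, Nat.card_eq_fintype_card, Fintype.card_fin] at this

lemma IsTournament.inDeg_lt_inDeg (hG : IsTournament G) (hA : IsAcyclic G) {u v : Fin n}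
    (huv : G.Adj u v) : inDeg G u < inDeg G v :=
  Set.ncard_lt_ncard ⟨fun _ hw => hG.trans_of_isAcyclic hA hw huv, fun h => hG.1 u (h huv)⟩
    (Set.toFinite _)

lemma IsTournament.adj_iff_inDeg_lt (hG : IsTournament G)
    (hinj : Function.Injective (inDeg G)) (u v : Fin n) :
    G.Adj v u ↔ inDeg G v < inDeg G u := by
  induction hd : inDeg G u using Nat.strong_induction_on generalizing u v with
  | _ d ih =>
    have hsub : {w | inDeg G w < d} ⊆ {w | G.Adj w u} := by
      intro w hw
      have hw' : inDeg G w < d := hw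
      have hne : w ≠ u := by rintro rfl; omega
      rcases hG.2 w u hne with h | h
      · exact h.1
      · have := (ih (inDeg G w) hw' w u rfl).1 h.1
        omega
    have hcard : {w | inDeg G w < d}.ncard = d := by
      let e : Fin n → Fin n := fun w => ⟨inDeg G w, hG.inDeg_lt w⟩
      have he : Function.Bijective e := Finite.injective_iff_bijective.1 fun a b hab =>
        hinj (Fin.mk.inj_iff.1 hab)
      have h1 : {w | inDeg G w < d} = e ⁻¹' {j | j.val < d} := rfl
      have hdn : d < n := hd ▸ hG.inDeg_lt u
      have h2 : {j : Fin n | j.val < d} = ((Finset.Iio (⟨d, hdn⟩ : Fin n) : Finset (Fin n)) :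
          Set (Fin n)) := by
        ext j
        simp [Fin.lt_def]
      rw [h1, Set.ncard_preimage_of_injective_subset_range he.1 (by simp [he.2.range_eq]), h2,
        Set.ncard_coe_finset, Fin.card_Iio]
    have heq := Set.eq_of_subset_of_ncard_le hsub (by rw [hcard, ← hd]; rfl) (Set.toFinite _)
    exact (Set.ext_iff.1 heq v).symm

/-- A tournament is acyclic if and only if its in-degrees are pairwise distinct. -/
lemma IsTournament.isAcyclic_iff (hG : IsTournament G) :
    IsAcyclic G ↔ Function.Injective (inDeg G) := by
  constructor
  · intro hA u v huv
    by_contra hne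
    rcases hG.2 u v hne with h | h
    · exact (hG.inDeg_lt_inDeg hA h.1).ne huv
    · exact (hG.inDeg_lt_inDeg hA h.1).ne' huv
  · intro h
    exact isAcyclic_of_rank (inDeg G) fun u v => (hG.adj_iff_inDeg_lt h v u).1

/-- A tournament is acyclic if and only if its minimum feedback arc set is empty. -/
lemma IsTournament.fasSize_eq_zero_iff (hG : IsTournament G) : fasSize G = 0 ↔ IsAcyclic G := by
  constructor
  · intro h
    obtain ⟨σ, hσ⟩ : fasSize G ∈ Set.range fun σ => (backEdges G σ).ncard :=
      Nat.sInf_mem (Set.range_nonempty _)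
    have hσ' : (backEdges G σ).ncard = 0 := hσ.trans h
    rw [Set.ncard_eq_zero (Set.toFinite _)] at hσ'
    refine isAcyclic_of_rank (fun v => (σ v).val) fun u v huv => ?_
    by_contra hlt
    have hne : σ u ≠ σ v := by
      intro h'
      rw [σ.injective h'] at huv
      exact hG.1 v huv
    have : (u, v) ∈ backEdges G σ :=
      ⟨huv, lt_of_le_of_ne (not_lt.1 hlt) hne.symm⟩
    rw [hσ'] at this
    exact this
  · intro hA
    let e : Fin n → Fin n := fun w => ⟨inDeg G w, hG.inDeg_lt w⟩
    have he : Function.Bijective e := Finite.injective_iff_bijective.1 fun a b hab =>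
      (hG.isAcyclic_iff.1 hA) (Fin.mk.inj_iff.1 hab)
    have h0 : backEdges G (Equiv.ofBijective e he) = ∅ := by
      rw [Set.eq_empty_iff_forall_notMem]
      rintro ⟨u, v⟩ ⟨h1, h2⟩
      have h3 : inDeg G v < inDeg G u := h2
      exact (hG.inDeg_lt_inDeg hA h1).not_gt h3
    apply Nat.eq_zero_of_le_zero
    have : fasSize G ≤ (backEdges G (Equiv.ofBijective e he)).ncard :=
      Nat.sInf_le ⟨_, rfl⟩
    rwa [h0, Set.ncard_empty] at this

lemma fasSizeApprox.acyc {α : ℝ} (hG : IsTournament G) {b : ℤ} (h : fasSizeApprox α G b) :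
    acyc G (decide (b = 0)) := by
  rw [TournamentStream.acyc, decide_eq_true_iff, ← hG.fasSize_eq_zero_iff]
  obtain ⟨h1, h2⟩ := h
  constructor
  · rintro rfl
    have : (fasSize G : ℝ) ≤ 0 := by simpa using h1
    exact_mod_cast le_antisymm this (Nat.cast_nonneg _)
  · intro h
    rw [h] at h1 h2
    simp only [Nat.cast_zero, mul_zero] at h1 h2
    exact_mod_cast le_antisymm h2 h1

lemma IsStreamOf.count_eq_inDeg {l : List (Fin n × Fin n)} (hl : IsStreamOf G l) (v : Fin n) :
    l.countP (fun e => e.2 = v) = inDeg G v := by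
  rw [List.countP_eq_length_filter,
    ← List.toFinset_card_of_nodup (hl.1.filter _), ← Set.ncard_coe_finset, inDeg]
  refine Set.ncard_congr (fun e _ => e.1) ?_ ?_ ?_
  · intro e he
    simp only [List.coe_toFinset, List.mem_filter, decide_eq_true_eq, Set.mem_ofPred_eq] at he
    have := (hl.2 e).1 he.1
    rw [he.2] at this
    exact this
  · intro e e' he he' hee
    simp only [List.coe_toFinset, List.mem_filter, decide_eq_true_eq, Set.mem_ofPred_eq] at he he'
    exact Prod.ext hee (he.2.trans he'.2.symm)
  · intro w hw
    exact ⟨(w, v), by simpa using (hl.2 (w, v)).2 hw, rfl⟩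

end Tournaments

section UpperBound

lemma log_two_le_of_two_le {n : ℕ} (hn : 2 ≤ n) :
    (Nat.log 2 n : ℝ) ≤ Real.log n / Real.log 2 ∧ 1 ≤ Real.log n / Real.log 2 := by
  have h2 : 0 < Real.log 2 := Real.log_pos (by norm_num)
  constructor
  · have := Real.natLog_le_logb n 2
    rwa [Real.logb] at this
  · rw [le_div_iff₀ h2, one_mul]
    exact Real.log_le_log (by norm_num) (by exact_mod_cast hn)

/-- The algorithm that counts the edges into each vertex, modulo `n`, in any encoding of
the counters. -/
def countAlg {n s : ℕ} [NeZero n] (enc : (Fin n → Fin n) → Fin (2 ^ s))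
    (dec : Fin (2 ^ s) → Fin n → Fin n) : StreamAlg (Fin n × Fin n) Bool s where
  init := enc fun _ => 0
  step _ _ m e := enc (Function.update (dec m) e.2 (dec m e.2 + 1))
  output m := decide (Function.Injective (dec m))

lemma countAlg_readFrom {n s : ℕ} [NeZero n] {enc : (Fin n → Fin n) → Fin (2 ^ s)}
    {dec : Fin (2 ^ s) → Fin n → Fin n} (h : ∀ f, dec (enc f) = f) (k i : ℕ)
    (l : List (Fin n × Fin n)) (f : Fin n → Fin n) (v : Fin n) :
    dec ((countAlg enc dec).readFrom k i l (enc f)) v =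
      f v + Fin.ofNat n (l.countP fun e => e.2 = v) := by
  induction l generalizing i f with
  | nil => simp [StreamAlg.readFrom, h]
  | cons e l ih =>
    rw [StreamAlg.readFrom]
    simp only [countAlg] at ih ⊢
    rw [ih, h, List.countP_cons]
    by_cases hv : e.2 = v
    · subst hv
      ext
      simp [Fin.val_add, add_comm, add_assoc]
    · simp [hv, Function.update_of_ne (Ne.symm hv)]

lemma exists_solves_acyc : ∃ C : ℝ, ∀ n : ℕ, 2 ≤ n → ∃ s : ℕ, (s : ℝ) ≤ C * (n * Real.log n) ∧
    ∃ A : StreamAlg (Fin n × Fin n) Bool s, Solves acyc 1 A := by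
  refine ⟨2 / Real.log 2, fun n hn => ⟨(Nat.log 2 n + 1) * n, ?_, ?_⟩⟩
  · obtain ⟨h1, h2⟩ := log_two_le_of_two_le hn
    push_cast
    have : (2 / Real.log 2) * (n * Real.log n) =
      (Real.log n / Real.log 2 + Real.log n / Real.log 2) * n := by ring
    rw [this]
    gcongr
  · have : NeZero n := ⟨by omega⟩
    have hcard : Fintype.card (Fin n → Fin n) ≤
        Fintype.card (Fin (2 ^ ((Nat.log 2 n + 1) * n))) := by
      simp only [Fintype.card_fun, Fintype.card_fin]
      rw [pow_mul]
      exact Nat.pow_le_pow_left (Nat.lt_pow_succ_log_self (by norm_num) n).le n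
    obtain ⟨enc⟩ := Function.Embedding.nonempty_of_card_le hcard
    refine ⟨countAlg enc (Function.invFun enc), fun G hG l hl => ?_⟩
    have hdec : ∀ f, Function.invFun enc (enc f) = f := Function.leftInverse_invFun enc.injective
    have hmem : ∀ v, Function.invFun enc ((countAlg enc (Function.invFun enc)).memAfter l 1) v =
        ⟨inDeg G v, hG.inDeg_lt v⟩ := by
      intro v
      have := countAlg_readFrom hdec 0 0 l (fun _ => 0) v
      rw [hl.count_eq_inDeg v] at this
      refine this.trans ?_
      ext
      simp [Nat.mod_eq_of_lt (hG.inDeg_lt v)]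
    have hout : (countAlg enc (Function.invFun enc)).run 1 l =
        decide (Function.Injective (inDeg G)) := by
      have h1 : Function.invFun enc ((countAlg enc (Function.invFun enc)).memAfter l 1) =
        fun v => ⟨inDeg G v, hG.inDeg_lt v⟩ := funext hmem
      change decide (Function.Injective
        (Function.invFun enc ((countAlg enc (Function.invFun enc)).memAfter l 1))) = _
      rw [h1, decide_eq_decide]
      simp only [Function.Injective, Fin.mk.injEq]
    rw [hout, acyc, decide_eq_true_iff, hG.isAcyclic_iff]

end UpperBound

section Machine

/-- The program. Cells `10 + v` count the edges into `v`; then the cells `10 + n + d` are used to mark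
the in-degrees `d` that have been seen, and the answer is `false` as soon as one of them
is seen twice. -/
def acycProgram : List Instr :=
  [ .const 5 1,       -- 0
    .const 6 10,      -- 1
    .add 8 6 0,       -- 2
    .next 1 2 9,      -- 3
    .add 3 6 2,       -- 4
    .load 4 3,        -- 5
    .add 4 4 5,       -- 6
    .store 3 4,       -- 7
    .jumpEq 0 0 3,    -- 8
    .jumpEq 7 0 18,   -- 9
    .add 3 6 7,       -- 10
    .load 4 3,        -- 11
    .add 3 8 4,       -- 12
    .load 4 3,        -- 13
    .jumpEq 4 5 19,   -- 14
    .store 3 5,       -- 15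
    .add 7 7 5,       -- 16
    .jumpEq 0 0 9,    -- 17
    .halt true,       -- 18
    .halt false ]     -- 19

/-- The memory `M` has zeros outside the first `m` cells, and at most `w` bits in each cell. -/
def MemWithin (m w : ℕ) (M : ℕ → ℕ) : Prop :=
  (∀ a, m ≤ a → M a = 0) ∧ ∀ a, M a < 2 ^ w

lemma MemWithin.update {m w : ℕ} {M : ℕ → ℕ} (h : MemWithin m w M) {a v : ℕ} (ha : a < m)
    (hv : v < 2 ^ w) : MemWithin m w (Function.update M a v) := by
  constructor
  · intro b hb
    rw [Function.update_of_ne (by omega)]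
    exact h.1 b hb
  · intro b
    by_cases hab : b = a
    · subst hab; simpa using hv
    · rw [Function.update_of_ne hab]
      exact h.2 b

/-- From the configuration `c`, the program stops with the answer `b`, and its memory
stays within the bounds `m` and `w`. -/
inductive HaltsWith (P : List Instr) (m w : ℕ) (b : Bool) : Config → Prop
  | halt (c : Config) (hc : MemWithin m w c.mem) (h : P[c.line]? = some (.halt b)) :
      HaltsWith P m w b c
  | step (c : Config) (hc : MemWithin m w c.mem) (h : HaltsWith P m w b (step P c)) :
      HaltsWith P m w b c

lemma HaltsWith.exists_halt {P : List Instr} {m w : ℕ} {b : Bool} {c : Config}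
    (h : HaltsWith P m w b c) : ∃ t, P[((TournamentStream.step P)^[t] c).line]? = some (.halt b) := by
  induction h with
  | halt c _ h => exact ⟨0, h⟩
  | step c _ _ ih =>
    obtain ⟨t, ht⟩ := ih
    exact ⟨t + 1, ht⟩

lemma HaltsWith.memWithin {P : List Instr} {m w : ℕ} {b : Bool} {c : Config}
    (h : HaltsWith P m w b c) (t : ℕ) : MemWithin m w ((TournamentStream.step P)^[t] c).mem := by
  induction h generalizing t with
  | halt c hc h =>
    have hfix : TournamentStream.step P c = c := by rw [TournamentStream.step, h]
    rwa [Function.iterate_fixed hfix]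
  | step c hc _ ih =>
    cases t with
    | zero => exact hc
    | succ t => exact ih t

section Instructions

variable {P : List Instr} {m w : ℕ} {ans : Bool} {i : ℕ} {M : ℕ → ℕ} {l : List (ℕ × ℕ)}

lemma HaltsWith.const {a v : ℕ} (hP : P[i]? = some (.const a v)) (hM : MemWithin m w M)
    (h : HaltsWith P m w ans ⟨i + 1, Function.update M a v, l⟩) : HaltsWith P m w ans ⟨i, M, l⟩ := by
  refine .step _ hM ?_
  simpa only [TournamentStream.step, hP] using h

lemma HaltsWith.add {a b c v : ℕ} (hP : P[i]? = some (.add a b c)) (hM : MemWithin m w M)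
    (hv : M b + M c = v)
    (h : HaltsWith P m w ans ⟨i + 1, Function.update M a v, l⟩) : HaltsWith P m w ans ⟨i, M, l⟩ := by
  refine .step _ hM ?_
  simpa only [TournamentStream.step, hP, hv] using h

lemma HaltsWith.load {a b q v : ℕ} (hP : P[i]? = some (.load a b)) (hM : MemWithin m w M)
    (hq : M b = q) (hv : M q = v)
    (h : HaltsWith P m w ans ⟨i + 1, Function.update M a v, l⟩) : HaltsWith P m w ans ⟨i, M, l⟩ := by
  refine .step _ hM ?_
  simpa only [TournamentStream.step, hP, hq, hv] using h

lemma HaltsWith.store {a b q v : ℕ} (hP : P[i]? = some (.store a b)) (hM : MemWithin m w M)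
    (hq : M a = q) (hv : M b = v)
    (h : HaltsWith P m w ans ⟨i + 1, Function.update M q v, l⟩) : HaltsWith P m w ans ⟨i, M, l⟩ := by
  refine .step _ hM ?_
  simpa only [TournamentStream.step, hP, hq, hv] using h

lemma HaltsWith.jump {a b t : ℕ} (hP : P[i]? = some (.jumpEq a b t)) (hM : MemWithin m w M)
    (hv : M a = M b) (h : HaltsWith P m w ans ⟨t, M, l⟩) : HaltsWith P m w ans ⟨i, M, l⟩ := by
  refine .step _ hM ?_
  simpa only [TournamentStream.step, hP, hv, if_true] using h

lemma HaltsWith.noJump {a b t : ℕ} (hP : P[i]? = some (.jumpEq a b t)) (hM : MemWithin m w M)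
    (hv : M a ≠ M b) (h : HaltsWith P m w ans ⟨i + 1, M, l⟩) : HaltsWith P m w ans ⟨i, M, l⟩ := by
  refine .step _ hM ?_
  simpa only [TournamentStream.step, hP, hv, if_false] using h

lemma HaltsWith.nextCons {a b t x y : ℕ} (hP : P[i]? = some (.next a b t)) (hM : MemWithin m w M)
    (h : HaltsWith P m w ans ⟨i + 1, Function.update (Function.update M a x) b y, l⟩) :
    HaltsWith P m w ans ⟨i, M, (x, y) :: l⟩ := by
  refine .step _ hM ?_
  simpa only [TournamentStream.step, hP] using h

lemma HaltsWith.nextNil {a b t : ℕ} (hP : P[i]? = some (.next a b t)) (hM : MemWithin m w M)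
    (h : HaltsWith P m w ans ⟨t, M, []⟩) : HaltsWith P m w ans ⟨i, M, []⟩ := by
  refine .step _ hM ?_
  simpa only [TournamentStream.step, hP] using h

end Instructions

/-- The contents of the memory, apart from the scratch registers: the counters are given by
`D`, the marks by `K`, and the loop counter is `j`. -/
structure MemState (n w : ℕ) (D K : ℕ → ℕ) (j : ℕ) (M : ℕ → ℕ) : Prop where
  within : MemWithin (10 + 2 * n) w M
  size : M 0 = n
  one : M 5 = 1
  base : M 6 = 10
  base' : M 8 = 10 + n
  counter : M 7 = j
  deg : ∀ v < n, M (10 + v) = D v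
  mark : ∀ d < n, M (10 + n + d) = K d

lemma haltsWith_readToken {n w : ℕ} (hw : 2 * n + 10 < 2 ^ w) {D K M : ℕ → ℕ} {j : ℕ}
    (hM : MemState n w D K j M) {b : Bool} {x y : ℕ} {l : List (ℕ × ℕ)} (hx : x < n) (hy : y < n)
    (hD : D y < n)
    (hnext : ∀ M', MemState n w (Function.update D y (D y + 1)) K j M' →
      HaltsWith acycProgram (10 + 2 * n) w b ⟨3, M', l⟩) :
    HaltsWith acycProgram (10 + 2 * n) w b ⟨3, M, (x, y) :: l⟩ := by
  have e1 := hM.within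
  have e2 := e1.update (a := 1) (v := x) (by omega) (by omega)
  have e3 := e2.update (a := 2) (v := y) (by omega) (by omega)
  have e4 := e3.update (a := 3) (v := 10 + y) (by omega) (by omega)
  have e5 := e4.update (a := 4) (v := D y) (by omega) (by omega)
  have e6 := e5.update (a := 4) (v := D y + 1) (by omega) (by omega)
  have e7 := e6.update (a := 10 + y) (v := D y + 1) (by omega) (by omega)
  have hne : 10 + y ≠ 1 ∧ 10 + y ≠ 2 ∧ 10 + y ≠ 3 ∧ 10 + y ≠ 4 := by omega
  obtain ⟨n1, n2, n3, n4⟩ := hne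
  refine .nextCons rfl e1 (.add rfl e3 (v := 10 + y) (by simp [hM.base])
    (.load rfl e4 (q := 10 + y) (v := D y) (by simp) (by simp [n1, n2, n3, hM.deg y hy])
    (.add rfl e5 (v := D y + 1) (by simp [hM.one])
    (.store rfl e6 (q := 10 + y) (v := D y + 1) (by simp) (by simp)
    (.jump rfl e7 rfl (hnext _ ⟨e7, ?_, ?_, ?_, ?_, ?_, ?_, ?_⟩))))))
  · rw [Function.update_of_ne (by omega)]; simp [hM.size]
  · rw [Function.update_of_ne (by omega)]; simp [hM.one]
  · rw [Function.update_of_ne (by omega)]; simp [hM.base]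
  · rw [Function.update_of_ne (by omega)]; simp [hM.base']
  · rw [Function.update_of_ne (by omega)]; simp [hM.counter]
  · intro v hv
    by_cases h : v = y
    · subst h; simp
    · rw [Function.update_of_ne (by omega), Function.update_of_ne h, Function.update_of_ne (by omega),
        Function.update_of_ne (by omega), Function.update_of_ne (by omega),
        Function.update_of_ne (by omega), Function.update_of_ne (by omega), hM.deg v hv]
  · intro d hd
    rw [Function.update_of_ne (by omega), Function.update_of_ne (by omega),
      Function.update_of_ne (by omega), Function.update_of_ne (by omega),
      Function.update_of_ne (by omega), Function.update_of_ne (by omega), hM.mark d hd]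

lemma haltsWith_readAll {n w : ℕ} (hw : 2 * n + 10 < 2 ^ w) {deg K : ℕ → ℕ} {j : ℕ}
    (hdeg : ∀ v < n, deg v < n) {b : Bool}
    (hnext : ∀ M', MemState n w deg K j M' → HaltsWith acycProgram (10 + 2 * n) w b ⟨9, M', []⟩)
    (l : List (ℕ × ℕ)) (hl : ∀ e ∈ l, e.1 < n ∧ e.2 < n) (D : ℕ → ℕ)
    (hD : ∀ v, D v + l.countP (fun e => e.2 = v) = deg v) (M : ℕ → ℕ)
    (hM : MemState n w D K j M) : HaltsWith acycProgram (10 + 2 * n) w b ⟨3, M, l⟩ := by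
  induction l generalizing D M with
  | nil =>
    have : D = deg := funext fun v => by simpa using hD v
    subst this
    exact .nextNil rfl hM.within (hnext M hM)
  | cons e l ih =>
    obtain ⟨x, y⟩ := e
    obtain ⟨hx, hy⟩ := hl (x, y) (by simp)
    have hlt : D y < n := by
      have h1 := hD y
      have h2 := hdeg y hy
      omega
    refine haltsWith_readToken hw hM hx hy hlt fun M' hM' =>
      ih (fun e he => hl e (by simp [he])) _ (fun v => ?_) M' hM'
    have h1 := hD v
    rw [List.countP_cons] at h1
    by_cases h : v = y
    · subst h
      simp only [decide_true, if_true] at h1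
      rw [Function.update_self]
      omega
    · simp only [decide_eq_true_eq, Ne.symm h, if_false] at h1
      rw [Function.update_of_ne h]
      omega

lemma haltsWith_check {n w : ℕ} (hw : 2 * n + 10 < 2 ^ w) {deg : ℕ → ℕ}
    (hdeg : ∀ v < n, deg v < n) {b : Bool} (hb : b = true ↔ Set.InjOn deg (Set.Iio n))
    (r j : ℕ) (hj : j + r = n) (K : ℕ → ℕ) (hK : ∀ d, K d = 1 ↔ ∃ u < j, deg u = d)
    (hK' : ∀ d, K d < 2) (hinj : Set.InjOn deg (Set.Iio j)) (M : ℕ → ℕ)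
    (hM : MemState n w deg K j M) : HaltsWith acycProgram (10 + 2 * n) w b ⟨9, M, []⟩ := by
  have e1 := hM.within
  induction r generalizing j K M with
  | zero =>
    have hjn : j = n := hj
    have : b = true := hb.2 (hjn ▸ hinj)
    subst this
    exact .jump rfl e1 (by rw [hM.counter, hM.size, hjn]) (.halt _ e1 rfl)
  | succ r ih =>
    have hjn : j < n := by omega
    have hd := hdeg j hjn
    have hk := hK' (deg j)
    have e2 := e1.update (a := 3) (v := 10 + j) (by omega) (by omega)
    have e3 := e2.update (a := 4) (v := deg j) (by omega) (by omega)
    have e4 := e3.update (a := 3) (v := 10 + n + deg j) (by omega) (by omega)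
    have e5 := e4.update (a := 4) (v := K (deg j)) (by omega) (by omega)
    refine .noJump rfl e1 (by rw [hM.counter, hM.size]; omega)
      (.add rfl e1 (v := 10 + j) (by rw [hM.base, hM.counter])
      (.load rfl e2 (q := 10 + j) (v := deg j) (by simp) ?_
      (.add rfl e3 (v := 10 + n + deg j) (by simp [hM.base'])
      (.load rfl e4 (q := 10 + n + deg j) (v := K (deg j)) (by simp) ?_ ?_))))
    · rw [Function.update_of_ne (by omega), hM.deg j hjn]
    · rw [Function.update_of_ne (by omega), Function.update_of_ne (by omega),
        Function.update_of_ne (by omega), hM.mark _ hd]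
    by_cases hmark : K (deg j) = 1
    · have : b = false := by
        rw [← Bool.not_eq_true, hb]
        intro hinj'
        obtain ⟨u, hu, huj⟩ := (hK _).1 hmark
        have := hinj' (Set.mem_Iio.2 (hu.trans hjn)) (Set.mem_Iio.2 hjn) huj
        omega
      subst this
      exact .jump rfl e5 (by simp [hM.one, hmark]) (.halt _ e5 rfl)
    · have e6 := e5.update (a := 10 + n + deg j) (v := 1) (by omega) (by omega)
      have e7 := e6.update (a := 7) (v := j + 1) (by omega) (by omega)
      refine .noJump rfl e5 (by simp [hM.one, hmark])
        (.store rfl e5 (q := 10 + n + deg j) (v := 1) (by simp) (by simp [hM.one])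
        (.add rfl e6 (v := j + 1) ?_ (.jump rfl e7 rfl
        (ih (j + 1) (by omega) (Function.update K (deg j) 1) ?_ ?_ ?_ _
          ⟨e7, ?_, ?_, ?_, ?_, ?_, ?_, ?_⟩ e7))))
      · rw [Function.update_of_ne (a := 7) (by omega), Function.update_of_ne (a := 5) (by omega)]
        simp [hM.counter, hM.one]
      · intro d
        by_cases h : d = deg j
        · subst h
          simp only [Function.update_self, true_iff]
          exact ⟨j, by omega, rfl⟩
        · rw [Function.update_of_ne h, hK]
          constructor
          · rintro ⟨u, hu, hud⟩
            exact ⟨u, by omega, hud⟩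
          · rintro ⟨u, hu, hud⟩
            have : u ≠ j := by rintro rfl; exact h hud.symm
            exact ⟨u, by omega, hud⟩
      · intro d
        by_cases h : d = deg j
        · subst h; simp
        · rw [Function.update_of_ne h]; exact hK' d
      · have hnot : ∀ u < j, deg u ≠ deg j := fun u hu h => hmark ((hK _).2 ⟨u, hu, h⟩)
        intro u hu v hv huv
        simp only [Set.mem_Iio] at hu hv
        rcases Nat.lt_succ_iff_lt_or_eq.1 hu with hu' | rfl
        · rcases Nat.lt_succ_iff_lt_or_eq.1 hv with hv' | rfl
          · exact hinj hu' hv' huv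
          · exact absurd huv (hnot u hu')
        · rcases Nat.lt_succ_iff_lt_or_eq.1 hv with hv' | rfl
          · exact absurd huv.symm (hnot v hv')
          · rfl
      · rw [Function.update_of_ne (by omega), Function.update_of_ne (by omega)]; simp [hM.size]
      · rw [Function.update_of_ne (by omega), Function.update_of_ne (by omega)]; simp [hM.one]
      · rw [Function.update_of_ne (by omega), Function.update_of_ne (by omega)]; simp [hM.base]
      · rw [Function.update_of_ne (by omega), Function.update_of_ne (by omega)]; simp [hM.base']
      · simp
      · intro v hv
        rw [Function.update_of_ne (by omega), Function.update_of_ne (by omega),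
          Function.update_of_ne (by omega), Function.update_of_ne (by omega),
          Function.update_of_ne (by omega), Function.update_of_ne (by omega), hM.deg v hv]
      · intro d hdn
        rw [Function.update_of_ne (by omega)]
        by_cases h : d = deg j
        · subst h; simp
        · rw [Function.update_of_ne (by omega), Function.update_of_ne h,
            Function.update_of_ne (by omega), Function.update_of_ne (by omega),
            Function.update_of_ne (by omega), Function.update_of_ne (by omega), hM.mark d hdn]

lemma haltsWith_start {n w : ℕ} (hw : 2 * n + 10 < 2 ^ w) {G : Digraph (Fin n)}
    (hG : IsTournament G) {l : List (Fin n × Fin n)} (hl : IsStreamOf G l) {b : Bool}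
    (hb : acyc G b) : HaltsWith acycProgram (10 + 2 * n) w b (start l) := by
  let l' : List (ℕ × ℕ) := l.map fun e => (e.1.val, e.2.val)
  let deg : ℕ → ℕ := fun v => l'.countP fun e => e.2 = v
  have hdegG : ∀ v : Fin n, deg v = inDeg G v := by
    intro v
    rw [← hl.count_eq_inDeg v]
    simp only [deg, l', List.countP_map]
    congr 1
    funext e
    simp [Fin.ext_iff]
  have hdeg : ∀ v < n, deg v < n := fun v hv => by
    rw [hdegG ⟨v, hv⟩]
    exact hG.inDeg_lt _
  have hinj : b = true ↔ Set.InjOn deg (Set.Iio n) := by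
    refine hb.trans (hG.isAcyclic_iff.trans ?_)
    constructor
    · intro h u hu v hv huv
      have h1 := hdegG ⟨u, hu⟩
      have h2 := hdegG ⟨v, hv⟩
      have := h (a₁ := ⟨u, hu⟩) (a₂ := ⟨v, hv⟩) (by rw [← h1, ← h2]; exact huv)
      exact Fin.mk.inj_iff.1 this
    · intro h u v huv
      rw [← hdegG, ← hdegG] at huv
      exact Fin.ext (h u.2 v.2 huv)
  have e1 : MemWithin (10 + 2 * n) w (Function.update (fun _ => 0) 0 n) :=
    MemWithin.update ⟨fun _ _ => rfl, fun _ => by positivity⟩ (by omega) (by omega)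
  have e2 := e1.update (a := 5) (v := 1) (by omega) (by omega)
  have e3 := e2.update (a := 6) (v := 10) (by omega) (by omega)
  have e4 := e3.update (a := 8) (v := 10 + n) (by omega) (by omega)
  refine .const rfl e1 (.const rfl e2 (.add rfl e3 (v := 10 + n) (by simp)
    (haltsWith_readAll hw hdeg (K := fun _ => 0) (j := 0) ?_ l' ?_ (fun _ => 0) ?_ _
      ⟨e4, by simp, by simp, by simp, by simp, by simp, ?_, ?_⟩)))
  · exact fun M hM => haltsWith_check hw hdeg hinj n 0 (by omega) _ (by simp) (by simp)
      (by simp [Set.InjOn]) M hM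
  · intro e he
    obtain ⟨e', -, rfl⟩ := List.mem_map.1 he
    exact ⟨e'.1.2, e'.2.2⟩
  · intro v
    simp [deg]
  · intro v hv
    rw [Function.update_of_ne (by omega), Function.update_of_ne (by omega),
      Function.update_of_ne (by omega), Function.update_of_ne (by omega)]
  · intro d hd
    rw [Function.update_of_ne (by omega), Function.update_of_ne (by omega),
      Function.update_of_ne (by omega), Function.update_of_ne (by omega)]

lemma exists_program_acyc : ∃ (P : List Instr) (C : ℝ), ∀ n : ℕ, 2 ≤ n →
    ∃ m w : ℕ, ((m * w : ℕ) : ℝ) ≤ C * (n * Real.log n) ∧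
      ∀ G : Digraph (Fin n), IsTournament G → ∀ l, IsStreamOf G l →
        (∃ b, Answers P l b ∧ acyc G b) ∧ WorksIn P l m w := by
  classical
  refine ⟨acycProgram, 42 / Real.log 2, fun n hn => ⟨10 + 2 * n, Nat.log 2 n + 5, ?_, ?_⟩⟩
  · obtain ⟨h1, h2⟩ := log_two_le_of_two_le hn
    have h3 : (42 / Real.log 2) * (n * Real.log n) =
      (7 * n) * (Real.log n / Real.log 2 + 5 * (Real.log n / Real.log 2)) := by ring
    have h4 : (2 : ℝ) ≤ n := by exact_mod_cast hn
    rw [h3]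
    push_cast
    apply mul_le_mul _ _ (by positivity) (by positivity)
    · linarith
    · linarith
  · intro G hG l hl
    have hw : 2 * n + 10 < 2 ^ (Nat.log 2 n + 5) := by
      have := Nat.lt_pow_succ_log_self (b := 2) (by norm_num) n
      have h : 2 ^ (Nat.log 2 n + 5) = 16 * 2 ^ (Nat.log 2 n).succ := by
        rw [Nat.succ_eq_add_one, pow_succ, pow_add]
        ring
      omega
    have hb : acyc G (decide (IsAcyclic G)) := decide_eq_true_iff
    have h := haltsWith_start hw hG hl hb
    exact ⟨⟨_, h.exists_halt, hb⟩, h.memWithin⟩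

end Machine

section Disjointness

variable {ι T : Type*} [Fintype ι] [DecidableEq ι] [DecidableEq T]

/-- The number of points of the cube at which `g` takes the value `t` and the `i`-th
coordinate is `u`. -/
def fibreCount (g : (ι → Bool) → T) (i : ι) (u : Bool) (t : T) : ℝ :=
  (#{z | z i = u ∧ g z = t} : ℕ)

/-- The sign of a bit. -/
def bitSign (b : Bool) : ℝ := if b then -1 else 1

lemma fibreCount_nonneg (g : (ι → Bool) → T) (i : ι) (u : Bool) (t : T) :
    0 ≤ fibreCount g i u t := Nat.cast_nonneg _

lemma fibreCount_add (g : (ι → Bool) → T) (i : ι) (t : T) :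
    fibreCount g i false t + fibreCount g i true t = (#{z | g z = t} : ℕ) := by
  unfold fibreCount
  rw [← Nat.cast_add, ← card_union_of_disjoint]
  · congr 2
    ext z
    simp only [mem_union, mem_filter, mem_univ, true_and]
    cases z i <;> simp
  · rw [disjoint_left]
    intro z
    simp only [mem_filter, mem_univ, true_and]
    rintro ⟨h, -⟩ ⟨h', -⟩
    simp [h] at h'

lemma sum_bitSign (g : (ι → Bool) → T) (i : ι) (t : T) :
    ∑ z with g z = t, bitSign (z i) = fibreCount g i false t - fibreCount g i true t := by
  have h : ∀ u, fibreCount g i u t = ∑ z with g z = t, if z i = u then (1 : ℝ) else 0 := by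
    intro u
    rw [fibreCount, sum_ite, sum_const_zero, add_zero, sum_const, nsmul_eq_mul, mul_one,
      filter_filter]
    simp only [and_comm]
  rw [h, h, ← sum_sub_distrib]
  refine sum_congr rfl fun z _ => ?_
  cases z i <;> simp [bitSign]

lemma sum_exp_le (b : ι → ℝ) :
    ∑ z : ι → Bool, Real.exp (∑ i, b i * bitSign (z i)) ≤
      2 ^ Fintype.card ι * Real.exp ((∑ i, b i ^ 2) / 2) := by
  have h : ∑ z : ι → Bool, Real.exp (∑ i, b i * bitSign (z i)) =
      ∏ i, ∑ c : Bool, Real.exp (b i * bitSign c) := by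
    rw [Finset.prod_univ_sum, Fintype.piFinset_univ]
    simp only [Real.exp_sum]
  rw [h, sum_div, Real.exp_sum, ← card_univ, ← prod_const, ← prod_mul_distrib]
  refine prod_le_prod (fun i _ => sum_nonneg fun c _ => (Real.exp_pos _).le) fun i _ => ?_
  have := Real.cosh_le_exp_half_sq (b i)
  rw [Real.cosh_eq] at this
  simp only [Fintype.sum_bool, bitSign, if_true, mul_neg, mul_one, Bool.false_eq_true, if_false]
  linarith

/-- The level-one inequality: the sum of the squares of the biases of the coordinates on a
fibre is at most twice the logarithm of the inverse density. -/
lemma level_one (g : (ι → Bool) → T) (t : T) :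
    ((#{z | g z = t} : ℕ) : ℝ) *
      Real.exp ((∑ i, ((fibreCount g i false t - fibreCount g i true t) /
        (#{z | g z = t} : ℕ)) ^ 2) / 2) ≤ 2 ^ Fintype.card ι := by
  set S : ℝ := ((#{z | g z = t} : ℕ) : ℝ) with hS
  set b : ι → ℝ := fun i => (fibreCount g i false t - fibreCount g i true t) / S with hb
  set B := ∑ i, b i ^ 2 with hB
  rcases (Nat.cast_nonneg (α := ℝ) (#{z | g z = t})).eq_or_lt with h0 | h0
  · rw [← hS] at h0
    rw [← h0, zero_mul]
    positivity
  have hsum : ∑ z with g z = t, (∑ i, b i * bitSign (z i)) = S * B := by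
    rw [sum_comm, hB, mul_sum]
    refine sum_congr rfl fun i _ => ?_
    rw [← mul_sum, sum_bitSign, hb]
    field_simp
  have h1 : S * Real.exp B ≤ ∑ z with g z = t, Real.exp (∑ i, b i * bitSign (z i)) := by
    calc S * Real.exp B
        = ∑ z with g z = t, Real.exp B * (1 + (∑ i, b i * bitSign (z i)) - B) := by
          rw [← mul_sum, sum_sub_distrib, sum_add_distrib, hsum]
          simp only [sum_const, nsmul_eq_mul, ← hS]
          ring
      _ ≤ _ := by
          refine sum_le_sum fun z _ => ?_
          have h2 := Real.add_one_le_exp ((∑ i, b i * bitSign (z i)) - B)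
          calc _ ≤ Real.exp B * Real.exp ((∑ i, b i * bitSign (z i)) - B) := by
                apply mul_le_mul_of_nonneg_left _ (Real.exp_pos _).le
                linarith
            _ = _ := by rw [← Real.exp_add]; congr 1; ring
  have h2 : ∑ z with g z = t, Real.exp (∑ i, b i * bitSign (z i)) ≤
      2 ^ Fintype.card ι * Real.exp (B / 2) :=
    (sum_le_sum_of_subset_of_nonneg (filter_subset _ _)
      fun _ _ _ => (Real.exp_pos _).le).trans (sum_exp_le b)
  have h3 : (S * Real.exp (B / 2)) * Real.exp (B / 2) ≤
      2 ^ Fintype.card ι * Real.exp (B / 2) := by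
    rw [mul_assoc, ← Real.exp_add, add_halves]
    exact h1.trans h2
  exact le_of_mul_le_mul_right h3 (Real.exp_pos _)

lemma sq_sqrt_sub_sqrt_le {a b : ℝ} (ha : 0 ≤ a) (hb : 0 ≤ b) :
    (√a - √b) ^ 2 ≤ (a + b) * ((a - b) / (a + b)) ^ 2 := by
  rcases (add_nonneg ha hb).eq_or_lt with h | h
  · have h1 : a = 0 := by linarith
    have h2 : b = 0 := by linarith
    simp [h1, h2]
  · have h3 : (a + b) * ((a - b) / (a + b)) ^ 2 = (a - b) ^ 2 / (a + b) := by
      field_simp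
    rw [h3, le_div_iff₀ h]
    have h4 : a - b = (√a - √b) * (√a + √b) := by
      nlinarith [Real.sq_sqrt ha, Real.sq_sqrt hb]
    rw [h4, mul_pow]
    refine mul_le_mul_of_nonneg_left ?_ (sq_nonneg _)
    nlinarith [Real.sq_sqrt ha, Real.sq_sqrt hb, mul_nonneg (Real.sqrt_nonneg a) (Real.sqrt_nonneg b)]

/-- The value of `g` reveals little about the coordinates on average, in terms of the squared
Hellinger distances. -/
lemma sum_hellinger_le [Fintype T] [Nonempty T] (g : (ι → Bool) → T) :
    ∑ i, ∑ t, (√(fibreCount g i false t) - √(fibreCount g i true t)) ^ 2 ≤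
      2 * 2 ^ Fintype.card ι * Real.log (Fintype.card T) := by
  set N : ℝ := 2 ^ Fintype.card ι with hN
  have hN0 : 0 < N := by positivity
  have hT : (0 : ℝ) < Fintype.card T := by exact_mod_cast Fintype.card_pos
  set S : T → ℝ := fun t => ((#{z | g z = t} : ℕ) : ℝ) with hS
  have hSsum : ∑ t, S t = N := by
    have := card_eq_sum_card_fiberwise (f := g) (s := univ) (t := univ) (by simp)
    simp only [hS, hN]
    rw [← Nat.cast_sum, ← this]
    simp
  rw [sum_comm]
  have key : ∀ t, ∑ i, (√(fibreCount g i false t) - √(fibreCount g i true t)) ^ 2 ≤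
      2 * (S t * Real.log (Fintype.card T) + N / Fintype.card T - S t) := by
    intro t
    set B := ∑ i, ((fibreCount g i false t - fibreCount g i true t) / S t) ^ 2 with hB
    have h1 : ∑ i, (√(fibreCount g i false t) - √(fibreCount g i true t)) ^ 2 ≤ S t * B := by
      rw [hB, mul_sum]
      refine sum_le_sum fun i _ => ?_
      have := sq_sqrt_sub_sqrt_le (fibreCount_nonneg g i false t) (fibreCount_nonneg g i true t)
      rwa [fibreCount_add] at this
    refine h1.trans ?_
    have h2 : S t * Real.exp (B / 2) ≤ N := level_one g t
    rcases (Nat.cast_nonneg (α := ℝ) (#{z | g z = t})).eq_or_lt with h0 | h0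
    · have h0' : S t = 0 := h0.symm
      rw [h0']
      have : 0 ≤ N / Fintype.card T := by positivity
      linarith
    · have h0' : 0 < S t := h0
      have h3 : B / 2 ≤ Real.log (N / S t) := by
        rw [Real.le_log_iff_exp_le (by positivity), le_div_iff₀ h0', mul_comm]
        exact h2
      have h4 := Real.log_le_sub_one_of_pos (x := N / S t / Fintype.card T) (by positivity)
      rw [Real.log_div (by positivity) hT.ne'] at h4
      have h5 : B / 2 ≤ Real.log (Fintype.card T) + (N / S t / Fintype.card T - 1) := by linarith
      have h6 := mul_le_mul_of_nonneg_left h5 h0'.le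
      have h7 : S t * (N / S t / Fintype.card T) = N / Fintype.card T := by field_simp
      nlinarith
  refine (sum_le_sum fun t _ => key t).trans (le_of_eq ?_)
  rw [← mul_sum, sum_sub_distrib, sum_add_distrib, ← sum_mul, hSsum, sum_const, card_univ,
    nsmul_eq_mul]
  field_simp
  ring

/-- Alice's input: the bits of `z` at the places marked by `d`. -/
def aliceBits (d z : ι → Bool) : ι → Bool := fun j => d j && z j

/-- Bob's input: the bits of `z` at the places not marked by `d`. -/
def bobBits (d z : ι → Bool) : ι → Bool := fun j => !d j && z j

/-- The number of `z` for which `f` takes the value `t` when the `i`-th bits of the inputs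
given by `d` and `z` are replaced by `u` and `v`. -/
def plantedCount (f : (ι → Bool) → (ι → Bool) → T) (d : ι → Bool) (i : ι) (u v : Bool) (t : T) :
    ℝ :=
  (#{z | f (Function.update (aliceBits d z) i u) (Function.update (bobBits d z) i v) = t} : ℕ)

lemma plantedCount_nonneg (f : (ι → Bool) → (ι → Bool) → T) (d : ι → Bool) (i : ι) (u v : Bool)
    (t : T) : 0 ≤ plantedCount f d i u v t := Nat.cast_nonneg _

lemma sum_plantedCount [Fintype T] (f : (ι → Bool) → (ι → Bool) → T) (d : ι → Bool) (i : ι) (u v : Bool) :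
    ∑ t, plantedCount f d i u v t = 2 ^ Fintype.card ι := by
  have := card_eq_sum_card_fiberwise (s := univ) (t := univ)
    (f := fun z => f (Function.update (aliceBits d z) i u) (Function.update (bobBits d z) i v))
    (by simp)
  simp only [plantedCount]
  rw [← Nat.cast_sum, ← this]
  simp

/-- Functions of complementary sets of coordinates are independent. -/
lemma sum_mul_of_indep (d : ι → Bool) (F G : (ι → Bool) → ℝ)
    (hF : ∀ z z', aliceBits d z = aliceBits d z' → F z = F z')
    (hG : ∀ z z', bobBits d z = bobBits d z' → G z = G z') :
    2 ^ Fintype.card ι * ∑ z, F z * G z = (∑ z, F z) * ∑ z, G z := by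
  let mix : (ι → Bool) × (ι → Bool) → (ι → Bool) × (ι → Bool) := fun q =>
    (fun j => if d j then q.1 j else q.2 j, fun j => if d j then q.2 j else q.1 j)
  have hmix : Function.Involutive mix := by
    rintro ⟨z, z'⟩
    ext j <;> simp only [mix] <;> split <;> rfl
  rw [sum_mul_sum, ← Fintype.sum_prod_type' (fun z z' => F z * G z'), ← hmix.bijective.sum_comp]
  have h : ∀ q : (ι → Bool) × (ι → Bool), F (mix q).1 * G (mix q).2 = F q.1 * G q.1 := by
    intro q
    rw [hF (mix q).1 q.1, hG (mix q).2 q.1]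
    · ext j
      simp only [mix, bobBits]
      cases d j <;> simp
    · ext j
      simp only [mix, aliceBits]
      cases d j <;> simp
  simp only [h]
  rw [Fintype.sum_prod_type]
  simp [mul_sum]

/-- Cut and paste. -/
lemma plantedCount_mul (f : (ι → Bool) → (ι → Bool) → T)
    (hf : ∀ x y x' y', f x y = f x' y' → f x y' = f x y) (d : ι → Bool) (i : ι) (t : T) :
    plantedCount f d i true false t * plantedCount f d i false true t =
      plantedCount f d i false false t * plantedCount f d i true true t := by
  classical
  let a : Bool → ℝ := fun u => ∑ z, if ∃ y, f (Function.update (aliceBits d z) i u) y = t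
    then 1 else 0
  let b : Bool → ℝ := fun v => ∑ z, if ∃ x, f x (Function.update (bobBits d z) i v) = t
    then 1 else 0
  have h : ∀ u v, 2 ^ Fintype.card ι * plantedCount f d i u v t = a u * b v := by
    intro u v
    rw [← sum_mul_of_indep d]
    · congr 1
      rw [plantedCount, card_filter, Nat.cast_sum]
      refine sum_congr rfl fun z _ => ?_
      rw [ite_zero_mul_ite_zero, mul_one, Nat.cast_ite, Nat.cast_one, Nat.cast_zero]
      congr 1
      apply propext
      constructor
      · intro h
        exact ⟨⟨_, h⟩, ⟨_, h⟩⟩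
      · rintro ⟨⟨y, hy⟩, ⟨x, hx⟩⟩
        rw [hf _ y x _ (hy.trans hx.symm), hy]
    · intro z z' h
      simp only [h]
    · intro z z' h
      simp only [h]
  have hN : (2 ^ Fintype.card ι * 2 ^ Fintype.card ι : ℝ) ≠ 0 := by positivity
  apply mul_left_cancel₀ hN
  calc _ = (2 ^ Fintype.card ι * plantedCount f d i true false t) *
        (2 ^ Fintype.card ι * plantedCount f d i false true t) := by ring
    _ = (2 ^ Fintype.card ι * plantedCount f d i false false t) *
        (2 ^ Fintype.card ι * plantedCount f d i true true t) := by
      rw [h, h, h, h]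
      ring
    _ = _ := by ring

lemma sum_hellinger_cut_paste_le [Fintype T] (f : (ι → Bool) → (ι → Bool) → T)
    (hf : ∀ x y x' y', f x y = f x' y' → f x y' = f x y) (d : ι → Bool) (i : ι) :
    ∑ t, (√(plantedCount f d i false false t) - √(plantedCount f d i true true t)) ^ 2 ≤
      2 * (∑ t, (√(plantedCount f d i false false t) - √(plantedCount f d i true false t)) ^ 2 +
        ∑ t, (√(plantedCount f d i false false t) - √(plantedCount f d i false true t)) ^ 2) := by
  have h : ∀ t, (√(plantedCount f d i false false t) - √(plantedCount f d i true true t)) ^ 2 ≤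
      2 * ((√(plantedCount f d i false false t) - √(plantedCount f d i true false t)) ^ 2 +
        (√(plantedCount f d i false false t) - √(plantedCount f d i false true t)) ^ 2) +
      (plantedCount f d i false false t + plantedCount f d i true true t
        - plantedCount f d i true false t - plantedCount f d i false true t) := by
    intro t
    have h1 : √(plantedCount f d i true false t) * √(plantedCount f d i false true t) =
        √(plantedCount f d i false false t) * √(plantedCount f d i true true t) := by
      rw [← Real.sqrt_mul (plantedCount_nonneg ..), ← Real.sqrt_mul (plantedCount_nonneg ..),
        plantedCount_mul f hf]
    have h2 := fun u v => Real.sq_sqrt (plantedCount_nonneg f d i u v t)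
    rw [← h2 false false, ← h2 true true, ← h2 true false, ← h2 false true]
    simp only [Real.sqrt_sq (Real.sqrt_nonneg _)]
    nlinarith [sq_nonneg (√(plantedCount f d i true false t) + √(plantedCount f d i false true t) -
      2 * √(plantedCount f d i false false t))]
  refine (sum_le_sum fun t _ => h t).trans (le_of_eq ?_)
  rw [sum_add_distrib, ← mul_sum, sum_add_distrib, sum_sub_distrib, sum_sub_distrib,
    sum_add_distrib]
  simp only [sum_plantedCount]
  ring

lemma plantedCount_update (f : (ι → Bool) → (ι → Bool) → T) (d : ι → Bool) (i : ι)
    (u v c : Bool) (t : T) :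
    plantedCount f (Function.update d i c) i u v t = plantedCount f d i u v t := by
  have h1 : ∀ z, Function.update (aliceBits (Function.update d i c) z) i u =
      Function.update (aliceBits d z) i u := by
    intro z
    ext j
    by_cases h : j = i
    · subst h; simp
    · simp [h, aliceBits]
  have h2 : ∀ z, Function.update (bobBits (Function.update d i c) z) i v =
      Function.update (bobBits d z) i v := by
    intro z
    ext j
    by_cases h : j = i
    · subst h; simp
    · simp [h, bobBits]
  simp only [plantedCount, h1, h2]

/-- Half of the points of a set that does not depend on the `i`-th coordinate have the `i`-th
coordinate `u`. -/
lemma card_filter_eq_two_mul (i : ι) (u : Bool) (p : (ι → Bool) → Prop) [DecidablePred p]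
    (hp : ∀ z c, p (Function.update z i c) ↔ p z) :
    #{z | p z} = 2 * #{z | z i = u ∧ p z} := by
  have h1 : #{z : ι → Bool | z i = u ∧ p z} = #{z : ι → Bool | z i ≠ u ∧ p z} := by
    refine card_nbij' (fun z => Function.update z i (!u)) (fun z => Function.update z i u)
      ?_ ?_ ?_ ?_
    · intro z hz
      simp only [coe_filter, mem_univ, true_and, Set.mem_ofPred_eq, hp] at hz ⊢
      exact ⟨by simp, hz.2⟩
    · intro z hz
      simp only [coe_filter, mem_univ, true_and, Set.mem_ofPred_eq, hp] at hz ⊢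
      exact ⟨by simp, hz.2⟩
    · intro z hz
      simp only [coe_filter, mem_univ, true_and, Set.mem_ofPred_eq] at hz
      simp [← hz.1]
    · intro z hz
      simp only [coe_filter, mem_univ, true_and, Set.mem_ofPred_eq] at hz
      have : (!u) = z i := by
        have := hz.1
        revert this
        cases z i <;> cases u <;> simp
      simp [this]
  have h2 := card_filter_add_card_filter_not (s := ({z | p z} : Finset (ι → Bool)))
    (fun z => z i = u)
  simp only [filter_filter] at h2
  simp only [and_comm (b := p _)] at h1 ⊢
  simp only [ne_eq] at h1
  omega

lemma plantedCount_alice (f : (ι → Bool) → (ι → Bool) → T) (d : ι → Bool) (i : ι) (hd : d i = true)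
    (u : Bool) (t : T) :
    plantedCount f d i u false t =
      2 * fibreCount (fun z => f (aliceBits d z) (bobBits d z)) i u t := by
  have hA : ∀ z c, Function.update (aliceBits d (Function.update z i c)) i u =
      Function.update (aliceBits d z) i u := by
    intro z c
    ext j
    by_cases h : j = i
    · subst h; simp
    · simp [h, aliceBits]
  have hB : ∀ z c, Function.update (bobBits d (Function.update z i c)) i false =
      Function.update (bobBits d z) i false := by
    intro z c
    ext j
    by_cases h : j = i
    · subst h; simp
    · simp [h, bobBits]
  rw [plantedCount, card_filter_eq_two_mul i u _ (fun z c => by rw [hA, hB]), fibreCount]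
  push_cast
  congr 3
  ext z
  simp only [mem_filter, mem_univ, true_and, and_congr_right_iff]
  intro hz
  have h1 : Function.update (aliceBits d z) i u = aliceBits d z := by
    rw [Function.update_eq_self_iff]; simp [aliceBits, hd, hz]
  have h2 : Function.update (bobBits d z) i false = bobBits d z := by
    rw [Function.update_eq_self_iff]; simp [bobBits, hd]
  rw [h1, h2]

lemma plantedCount_bob (f : (ι → Bool) → (ι → Bool) → T) (d : ι → Bool) (i : ι) (hd : d i = false)
    (v : Bool) (t : T) :
    plantedCount f d i false v t =
      2 * fibreCount (fun z => f (aliceBits d z) (bobBits d z)) i v t := by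
  have h := plantedCount_alice (fun x y => f y x) (fun j => !d j) i (by simp [hd]) v t
  have h1 : aliceBits (fun j => !d j) = bobBits d := rfl
  have h2 : bobBits (fun j => !d j) = aliceBits d := by
    ext z j; simp [aliceBits, bobBits]
  rw [plantedCount, h1, h2] at h
  exact h

/-- The information that the value of `f` gives on the `i`-th bit, as a squared Hellinger
distance. -/
noncomputable def bitLeak [Fintype T] (f : (ι → Bool) → (ι → Bool) → T) (i : ι) (d : ι → Bool) : ℝ :=
  ∑ t, (√(fibreCount (fun z => f (aliceBits d z) (bobBits d z)) i false t) -
    √(fibreCount (fun z => f (aliceBits d z) (bobBits d z)) i true t)) ^ 2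

lemma sqrt_two_mul_sub_sq (a b : ℝ) : (√(2 * a) - √(2 * b)) ^ 2 = 2 * (√a - √b) ^ 2 := by
  rw [Real.sqrt_mul (by norm_num), Real.sqrt_mul (by norm_num), ← mul_sub, mul_pow,
    Real.sq_sqrt (by norm_num)]

lemma sum_update_add_update (i : ι) (F : (ι → Bool) → ℝ) :
    ∑ d, (F (Function.update d i true) + F (Function.update d i false)) = 2 * ∑ d, F d := by
  let flip : (ι → Bool) → (ι → Bool) := fun d => Function.update d i (!d i)
  have hflip : Function.Involutive flip := by
    intro d
    simp [flip]
  have h : ∀ d, F (Function.update d i true) + F (Function.update d i false) =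
      F d + F (flip d) := by
    intro d
    cases hd : d i
    · have : Function.update d i false = d := by rw [← hd]; simp
      simp only [this, flip, hd, Bool.not_false]
      ring
    · have : Function.update d i true = d := by rw [← hd]; simp
      simp only [this, flip, hd, Bool.not_true]
  simp only [h]
  rw [sum_add_distrib, hflip.bijective.sum_comp]
  ring

lemma sum_planted_hellinger_le [Fintype T] (f : (ι → Bool) → (ι → Bool) → T)
    (hf : ∀ x y x' y', f x y = f x' y' → f x y' = f x y) (i : ι) :
    ∑ d, ∑ t, (√(plantedCount f d i false false t) - √(plantedCount f d i true true t)) ^ 2 ≤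
      8 * ∑ d, bitLeak f i d := by
  have h : ∀ d, ∑ t, (√(plantedCount f d i false false t) -
        √(plantedCount f d i true true t)) ^ 2 ≤
      4 * (bitLeak f i (Function.update d i true) + bitLeak f i (Function.update d i false)) := by
    intro d
    have h1 : ∑ t, (√(plantedCount f d i false false t) -
        √(plantedCount f d i true false t)) ^ 2 =
        2 * bitLeak f i (Function.update d i true) := by
      rw [bitLeak, mul_sum]
      refine sum_congr rfl fun t _ => ?_
      rw [← sqrt_two_mul_sub_sq, ← plantedCount_alice _ _ _ (by simp),
        ← plantedCount_alice _ _ _ (by simp), plantedCount_update, plantedCount_update]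
    have h2 : ∑ t, (√(plantedCount f d i false false t) -
        √(plantedCount f d i false true t)) ^ 2 =
        2 * bitLeak f i (Function.update d i false) := by
      rw [bitLeak, mul_sum]
      refine sum_congr rfl fun t _ => ?_
      rw [← sqrt_two_mul_sub_sq, ← plantedCount_bob _ _ _ (by simp),
        ← plantedCount_bob _ _ _ (by simp), plantedCount_update, plantedCount_update]
    have := sum_hellinger_cut_paste_le f hf d i
    rw [h1, h2] at this
    linarith
  refine (sum_le_sum fun d _ => h d).trans (le_of_eq ?_)
  rw [← mul_sum, sum_update_add_update]
  ring

/-- The number of `z` for which the answer `out` is wrong on the inputs given by `d` and `z` with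
the `i`-th bits replaced by `b`; the right answer is `!b`. -/
def plantedErrors (f : (ι → Bool) → (ι → Bool) → T) (out : T → Bool) (d : ι → Bool) (i : ι)
    (b : Bool) : ℕ :=
  #{z | out (f (Function.update (aliceBits d z) i b) (Function.update (bobBits d z) i b)) = b}

lemma sum_bitSign_plantedCount [Fintype T] (f : (ι → Bool) → (ι → Bool) → T) (out : T → Bool) (d : ι → Bool)
    (i : ι) (b : Bool) :
    ∑ t, bitSign (!out t) * plantedCount f d i b b t =
      bitSign b * (2 ^ Fintype.card ι - 2 * plantedErrors f out d i b) := by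
  have h1 : ∀ t, bitSign (!out t) * plantedCount f d i b b t =
      ∑ z : ι → Bool, if f (Function.update (aliceBits d z) i b)
        (Function.update (bobBits d z) i b) = t then bitSign (!out t) else 0 := by
    intro t
    rw [plantedCount, ← sum_filter, sum_const, nsmul_eq_mul, mul_comm]
  simp only [h1]
  rw [sum_comm]
  simp only [sum_ite_eq, mem_univ, if_true]
  have h2 : (2 ^ Fintype.card ι : ℝ) = ∑ z : ι → Bool, 1 := by simp
  have h3 : (plantedErrors f out d i b : ℝ) = ∑ z : ι → Bool,
      if out (f (Function.update (aliceBits d z) i b) (Function.update (bobBits d z) i b)) = b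
      then 1 else 0 := by
    rw [plantedErrors, card_filter]
    push_cast
    rfl
  rw [h2, h3, mul_sum, ← sum_sub_distrib, mul_sum]
  refine sum_congr rfl fun z _ => ?_
  cases out _ <;> cases b <;> norm_num [bitSign]

lemma le_hellinger_of_errors [Fintype T] (f : (ι → Bool) → (ι → Bool) → T) (out : T → Bool) (d : ι → Bool)
    (i : ι) :
    2 * 2 ^ Fintype.card ι - 2 * ((plantedErrors f out d i false : ℝ) +
        plantedErrors f out d i true) ≤
      3 * ∑ t, (√(plantedCount f d i false false t) - √(plantedCount f d i true true t)) ^ 2 +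
        2 ^ Fintype.card ι / 3 := by
  have h0 := sum_bitSign_plantedCount f out d i false
  have h1 := sum_bitSign_plantedCount f out d i true
  simp only [bitSign, if_true, Bool.false_eq_true, if_false] at h0 h1
  have h : ∀ t, bitSign (!out t) * plantedCount f d i false false t -
      bitSign (!out t) * plantedCount f d i true true t ≤
      3 * (√(plantedCount f d i false false t) - √(plantedCount f d i true true t)) ^ 2 +
      (plantedCount f d i false false t + plantedCount f d i true true t) / 6 := by
    intro t
    have h2 := fun u v => Real.sq_sqrt (plantedCount_nonneg f d i u v t)
    have h3 : ∀ s a b : ℝ, s = 1 ∨ s = -1 →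
        s * a ^ 2 - s * b ^ 2 ≤ 3 * (a - b) ^ 2 + (a ^ 2 + b ^ 2) / 6 := by
      rintro s a b (rfl | rfl)
      · nlinarith [sq_nonneg (6 * (a - b) - (a + b)), sq_nonneg (a - b)]
      · nlinarith [sq_nonneg (6 * (a - b) + (a + b)), sq_nonneg (a - b)]
    have h4 := h3 (bitSign (!out t)) (√(plantedCount f d i false false t))
      (√(plantedCount f d i true true t)) (by cases out t <;> simp [bitSign])
    rwa [h2, h2] at h4
  have := sum_le_sum fun t (_ : t ∈ univ) => h t
  rw [sum_sub_distrib, sum_add_distrib, ← mul_sum, ← sum_div, sum_add_distrib, sum_plantedCount,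
    sum_plantedCount] at this
  simp only [bitSign] at this
  rw [h0, h1] at this
  linarith

/-- Disjointness is hard: if a function with rectangular fibres determines, with error at most `1/3`
on the hard distribution, whether the inputs are disjoint, then it has many values. -/
theorem card_le_log_of_errors [Fintype T] [Nonempty T] (f : (ι → Bool) → (ι → Bool) → T)
    (hf : ∀ x y x' y', f x y = f x' y' → f x y' = f x y) (out : T → Bool)
    (herr : 3 * ∑ i, ∑ d, (plantedErrors f out d i false + plantedErrors f out d i true) ≤
      2 * Fintype.card ι * (2 ^ Fintype.card ι * 2 ^ Fintype.card ι)) :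
    (Fintype.card ι : ℝ) ≤ 144 * Real.log (Fintype.card T) := by
  set N : ℝ := 2 ^ Fintype.card ι with hN
  have hN0 : 0 < N := by positivity
  have hcard : ((univ : Finset (ι → Bool)).card : ℝ) = N := by simp [hN]
  have h1 : ∑ i : ι, ∑ d, (2 * N - 2 * ((plantedErrors f out d i false : ℝ) +
      plantedErrors f out d i true)) ≤ ∑ i : ι, (3 * (8 * ∑ d, bitLeak f i d) + N * (N / 3)) := by
    refine sum_le_sum fun i _ => ?_
    refine (sum_le_sum fun d _ => le_hellinger_of_errors f out d i).trans ?_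
    rw [sum_add_distrib, ← mul_sum, sum_const, nsmul_eq_mul, hcard]
    gcongr
    exact sum_planted_hellinger_le f hf i
  have h2 : ∑ i, ∑ d, bitLeak f i d ≤ N * (2 * N * Real.log (Fintype.card T)) := by
    rw [sum_comm]
    refine (sum_le_sum fun d _ => sum_hellinger_le _).trans (le_of_eq ?_)
    rw [sum_const, nsmul_eq_mul, hcard]
  have h3 : 3 * ∑ i, ∑ d, ((plantedErrors f out d i false : ℝ) + plantedErrors f out d i true) ≤
      2 * Fintype.card ι * (N * N) := by
    rw [hN]
    exact_mod_cast herr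
  rw [sum_add_distrib, ← mul_sum, ← mul_sum, sum_const, card_univ, nsmul_eq_mul] at h1
  rw [card_univ] at hcard
  simp only [sum_sub_distrib, ← mul_sum, sum_const, nsmul_eq_mul, card_univ, hcard] at h1
  have h4 : (N * N) * Fintype.card ι ≤ (N * N) * (144 * Real.log (Fintype.card T)) := by
    nlinarith
  exact le_of_mul_le_mul_left h4 (by positivity)

end Disjointness

section Communication

lemma StreamAlg.readFrom_append {τ β : Type*} {s : ℕ} (A : StreamAlg τ β s) (k i : ℕ)
    (l l' : List τ) (m : Fin (2 ^ s)) :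
    A.readFrom k i (l ++ l') m = A.readFrom k (i + l.length) l' (A.readFrom k i l m) := by
  induction l generalizing i m with
  | nil => rfl
  | cons e l ih =>
    simp only [List.cons_append, StreamAlg.readFrom, List.length_cons, ih]
    congr 1
    omega

/-- A `p`-pass algorithm yields a two-party protocol, whose transcript lists the memory
contents whenever one of the two parts of the stream has been read. -/
lemma StreamAlg.exists_transcript {τ β X Y : Type*} {s p : ℕ} (A : StreamAlg τ β s) (hp : 1 ≤ p)
    (lA : X → List τ) (lB : Y → List τ) (hlen : ∀ x x', (lA x).length = (lA x').length) :
    ∃ (f : X → Y → Fin p → Fin (2 ^ s) × Fin (2 ^ s))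
      (out : (Fin p → Fin (2 ^ s) × Fin (2 ^ s)) → β),
      (∀ x y x' y', f x y = f x' y' → f x y' = f x y) ∧
      ∀ x y, out (f x y) = A.run p (lA x ++ lB y) := by
  let mid : X → Y → ℕ → Fin (2 ^ s) := fun x y k =>
    A.readFrom k 0 (lA x) (A.memAfter (lA x ++ lB y) k)
  have hsucc : ∀ x y k, A.memAfter (lA x ++ lB y) (k + 1) =
      A.readFrom k (lA x).length (lB y) (mid x y k) := by
    intro x y k
    rw [StreamAlg.memAfter, StreamAlg.readFrom_append, Nat.zero_add]
  refine ⟨fun x y k => (mid x y k, A.memAfter (lA x ++ lB y) (k + 1)),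
    fun t => A.output (t ⟨p - 1, by omega⟩).2, ?_, ?_⟩
  · intro x y x' y' h
    have hk : ∀ k < p, mid x y k = mid x' y' k ∧
        A.memAfter (lA x ++ lB y) (k + 1) = A.memAfter (lA x' ++ lB y') (k + 1) := fun k hk =>
      Prod.mk.inj (congrFun h ⟨k, hk⟩)
    have hmid : ∀ k, A.memAfter (lA x ++ lB y') k = A.memAfter (lA x ++ lB y) k →
        mid x y' k = mid x y k := by
      intro k h
      simp only [mid, h]
    have hmem : ∀ k ≤ p, A.memAfter (lA x ++ lB y') k = A.memAfter (lA x ++ lB y) k := by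
      intro k
      induction k with
      | zero => exact fun _ => rfl
      | succ k ih =>
        intro hkp
        rw [hsucc, hmid k (ih (by omega)), (hk k hkp).1, hlen x x', ← hsucc, (hk k hkp).2]
    funext k
    exact Prod.ext (hmid k (hmem k k.2.le)) (hmem (k + 1) k.2)
  · intro x y
    simp only [StreamAlg.run]
    rw [Nat.sub_add_cancel hp]

/-- If each of finitely many events has probability at most `1/3`, then some outcome lies in at
most a third of them. -/
lemma exists_card_le_of_measure_le {Ω J : Type*} [MeasurableSpace Ω] [Fintype J]
    (μ : MeasureTheory.Measure Ω) [MeasureTheory.IsProbabilityMeasure μ] (B : J → Set Ω)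
    (hB : ∀ j, μ (B j) ≤ 1 / 3) (S : Ω → Finset J) (hS : ∀ ω, ∀ j ∈ S ω, ω ∈ B j) :
    ∃ ω, 3 * #(S ω) ≤ Fintype.card J := by
  classical
  by_contra! hcon
  let E : J → Set Ω := fun j => MeasureTheory.toMeasurable μ (B j)
  have hE : ∀ j, MeasurableSet (E j) := fun j => MeasureTheory.measurableSet_toMeasurable _ _
  have h1 : ∀ ω, ((Fintype.card J : ENNReal) + 1) ≤ 3 * ∑ j, (E j).indicator 1 ω := by
    intro ω
    have h2 : ((#(S ω) : ℕ) : ENNReal) ≤ ∑ j, (E j).indicator 1 ω := by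
      calc ((#(S ω) : ℕ) : ENNReal) = ∑ j ∈ S ω, 1 := by simp
        _ ≤ ∑ j ∈ S ω, (E j).indicator 1 ω := by
          refine sum_le_sum fun j hj => ?_
          rw [Set.indicator_of_mem (MeasureTheory.subset_toMeasurable _ _ (hS ω j hj))]
          rfl
        _ ≤ _ := sum_le_sum_of_subset (subset_univ _)
    have h3 : ((Fintype.card J + 1 : ℕ) : ENNReal) ≤ ((3 * #(S ω) : ℕ) : ENNReal) := by
      exact_mod_cast hcon ω
    push_cast at h3
    exact h3.trans (mul_le_mul_right h2 _)
  have h4 := MeasureTheory.lintegral_mono (μ := μ) h1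
  rw [MeasureTheory.lintegral_const, MeasureTheory.measure_univ, mul_one,
    MeasureTheory.lintegral_const_mul' _ _ (by norm_num),
    MeasureTheory.lintegral_finsetSum _ fun j _ => measurable_one.indicator (hE j)] at h4
  have h5 : ∑ j, ∫⁻ ω, (E j).indicator 1 ω ∂μ ≤ (Fintype.card J : ENNReal) * (1 / 3) := by
    calc ∑ j, ∫⁻ ω, (E j).indicator 1 ω ∂μ ≤ ∑ _j : J, (1 / 3 : ENNReal) := by
          refine sum_le_sum fun j _ => ?_
          rw [MeasureTheory.lintegral_indicator_one (hE j), MeasureTheory.measure_toMeasurable]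
          exact hB j
      _ = _ := by rw [sum_const, card_univ, nsmul_eq_mul]
  have h6 := h4.trans (mul_le_mul_right h5 3)
  have h7 : (3 : ENNReal) * (Fintype.card J * (1 / 3)) = Fintype.card J := by
    rw [mul_left_comm, one_div, ENNReal.mul_inv_cancel (by norm_num) (by norm_num), mul_one]
  rw [h7] at h6
  have h8 : ((Fintype.card J + 1 : ℕ) : ENNReal) ≤ (Fintype.card J : ℕ) := by exact_mod_cast h6
  have := Nat.cast_le.1 h8
  omega

end Communication

section Reduction

variable {n k : ℕ}

/-- Alice's bits say which of the pairs `(3 * i, 3 * i + 1)` are reversed. -/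
def aliceRev (x : Fin k → Bool) (e : Fin n × Fin n) : Prop :=
  ∃ i : Fin k, e.1.val = 3 * i ∧ e.2.val = 3 * i + 1 ∧ x i = true

/-- Bob's bits say which of the pairs `(3 * i + 1, 3 * i + 2)` are reversed. -/
def bobRev (y : Fin k → Bool) (e : Fin n × Fin n) : Prop :=
  ∃ i : Fin k, e.1.val = 3 * i + 1 ∧ e.2.val = 3 * i + 2 ∧ y i = true

/-- The transitive tournament with the edges chosen by Alice and by Bob reversed. -/
def triangles (n : ℕ) (x y : Fin k → Bool) : Digraph (Fin n) where
  Adj u v := (u < v ∧ ¬ (aliceRev x (u, v) ∨ bobRev y (u, v))) ∨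
    (v < u ∧ (aliceRev x (v, u) ∨ bobRev y (v, u)))

lemma isTournament_triangles (x y : Fin k → Bool) : IsTournament (triangles n x y) := by
  constructor
  · intro v h
    rcases h with h | h <;> exact lt_irrefl _ h.1
  · intro v w hne
    have h : ∀ a b : Fin n, a < b → ¬ b < a := fun a b h => not_lt.2 h.le
    simp only [Xor, triangles]
    rcases lt_or_gt_of_ne hne with hlt | hlt
    · have := h _ _ hlt
      tauto
    · have := h _ _ hlt
      tauto

lemma not_isAcyclic_triangles (hk : 3 * k ≤ n) {x y : Fin k → Bool} {i : Fin k}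
    (hx : x i = true) (hy : y i = true) : ¬ IsAcyclic (triangles n x y) := by
  intro h
  have hi := i.2
  let a : Fin n := ⟨3 * i, by omega⟩
  let b : Fin n := ⟨3 * i + 1, by omega⟩
  let c : Fin n := ⟨3 * i + 2, by omega⟩
  have hac : (triangles n x y).Adj a c := by
    refine Or.inl ⟨by simp [a, c], ?_⟩
    rintro (⟨j, h1, h2, -⟩ | ⟨j, h1, h2, -⟩) <;> simp only [a, c] at h1 h2 <;> omega
  have hcb : (triangles n x y).Adj c b :=
    Or.inr ⟨by simp [b, c], Or.inr ⟨i, rfl, rfl, hy⟩⟩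
  have hba : (triangles n x y).Adj b a :=
    Or.inr ⟨by simp [a, b], Or.inl ⟨i, rfl, rfl, hx⟩⟩
  exact h a (.tail (.tail (.single hac) hcb) hba)

/-- The position of a vertex in an order of the vertices that has the edges of `triangles n x y`
as forward edges, when `x` and `y` are disjoint. -/
def trianglesRank (x y : Fin k → Bool) (v : ℕ) : ℕ :=
  if h : v / 3 < k then
    if v % 3 = 0 then v + (x ⟨v / 3, h⟩).toNat
    else if v % 3 = 1 then v + (y ⟨v / 3, h⟩).toNat - (x ⟨v / 3, h⟩).toNat
    else v - (y ⟨v / 3, h⟩).toNat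
  else v

lemma trianglesRank_fst (x y : Fin k → Bool) (i : Fin k) :
    trianglesRank x y (3 * i) = 3 * i + (x i).toNat := by
  have h : 3 * i.val / 3 = i := by omega
  simp [trianglesRank, h]

lemma trianglesRank_snd (x y : Fin k → Bool) (i : Fin k) :
    trianglesRank x y (3 * i + 1) = 3 * i + 1 + (y i).toNat - (x i).toNat := by
  have h : (3 * i.val + 1) / 3 = i := by omega
  have h' : (3 * i.val + 1) % 3 = 1 := by omega
  simp [trianglesRank, h, h']

lemma trianglesRank_trd (x y : Fin k → Bool) (i : Fin k) :
    trianglesRank x y (3 * i + 2) = 3 * i + 2 - (y i).toNat := by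
  have h : (3 * i.val + 2) / 3 = i := by omega
  have h' : (3 * i.val + 2) % 3 = 2 := by omega
  simp [trianglesRank, h, h']

lemma trianglesRank_div (x y : Fin k → Bool) (v : ℕ) : trianglesRank x y v / 3 = v / 3 := by
  unfold trianglesRank
  split_ifs with h
  all_goals try have := Bool.toNat_le (x ⟨v / 3, h⟩)
  all_goals try have := Bool.toNat_le (y ⟨v / 3, h⟩)
  all_goals omega

lemma isAcyclic_triangles {x y : Fin k → Bool} (hxy : ∀ i, ¬ (x i = true ∧ y i = true)) :
    IsAcyclic (triangles n x y) := by
  refine isAcyclic_of_rank (fun v => trianglesRank x y v.val) fun u v huv => ?_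
  have hdis : ∀ i, (x i).toNat + (y i).toNat ≤ 1 := by
    intro i
    have := hxy i
    revert this
    cases x i <;> cases y i <;> simp
  rcases huv with ⟨hlt, hrev⟩ | ⟨hlt, ⟨i, h1, h2, h3⟩ | ⟨i, h1, h2, h3⟩⟩
  · have hlt' : u.val < v.val := hlt
    by_cases hblock : u.val / 3 < v.val / 3
    · have h1 := trianglesRank_div x y u
      have h2 := trianglesRank_div x y v
      omega
    by_cases hk : u.val / 3 < k
    · obtain ⟨i, hi⟩ : ∃ i : Fin k, i.val = u.val / 3 := ⟨⟨u.val / 3, hk⟩, rfl⟩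
      have hd := hdis i
      have hcases : (u.val = 3 * i ∧ v.val = 3 * i + 1) ∨ (u.val = 3 * i ∧ v.val = 3 * i + 2) ∨
          (u.val = 3 * i + 1 ∧ v.val = 3 * i + 2) := by omega
      rcases hcases with ⟨h1, h2⟩ | ⟨h1, h2⟩ | ⟨h1, h2⟩
      · have hx : x i = false := by
          rw [← Bool.not_eq_true]
          exact fun h => hrev (Or.inl ⟨i, h1, h2, h⟩)
        simp only [h1, h2, trianglesRank_fst, trianglesRank_snd, hx, Bool.toNat_false]
        omega
      · simp only [h1, h2, trianglesRank_fst, trianglesRank_trd]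
        omega
      · have hy : y i = false := by
          rw [← Bool.not_eq_true]
          exact fun h => hrev (Or.inr ⟨i, h1, h2, h⟩)
        simp only [h1, h2, trianglesRank_snd, trianglesRank_trd, hy, Bool.toNat_false]
        omega
    · have hkv : ¬ v.val / 3 < k := by omega
      simpa [trianglesRank, hk, hkv] using hlt
  · have hd := hdis i
    simp only at h1 h2
    simp only [h1, h2, trianglesRank_fst, trianglesRank_snd]
    simp only [h3, Bool.toNat_true] at hd ⊢
    omega
  · have hd := hdis i
    simp only at h1 h2
    simp only [h1, h2, trianglesRank_snd, trianglesRank_trd]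
    simp only [h3, Bool.toNat_true] at hd ⊢
    omega

/-- The pair `e`, reversed if `r e`. -/
noncomputable def orient (r : Fin n × Fin n → Prop) (e : Fin n × Fin n) : Fin n × Fin n :=
  open Classical in if r e then e.swap else e

lemma orient_inj {r r' : Fin n × Fin n → Prop} {e e' : Fin n × Fin n} (he : e.1 < e.2)
    (he' : e'.1 < e'.2) (h : orient r e = orient r' e') : e = e' := by
  unfold orient at h
  split_ifs at h
  · exact Prod.swap_injective h
  · rw [← h] at he'
    exact absurd he (not_lt.2 he'.le)
  · rw [h] at he
    exact absurd he (not_lt.2 he'.le)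
  · exact h

lemma orient_congr {r r' : Fin n × Fin n → Prop} {e : Fin n × Fin n} (h : r e ↔ r' e) :
    orient r e = orient r' e := by
  unfold orient
  by_cases hr : r e
  · rw [if_pos hr, if_pos (h.1 hr)]
  · rw [if_neg hr, if_neg (mt h.2 hr)]

/-- The increasing pairs of vertices, those of the form `(3 * i + 1, 3 * i + 2)` (`b = true`) or the
others (`b = false`). -/
noncomputable def incPairs (n : ℕ) (b : Bool) : List (Fin n × Fin n) :=
  ({e | e.1 < e.2 ∧ decide (e.1.val % 3 = 1 ∧ e.2.val = e.1.val + 1) = b} :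
    Finset (Fin n × Fin n)).toList

lemma mem_incPairs {b : Bool} {e : Fin n × Fin n} : e ∈ incPairs n b ↔
    e.1 < e.2 ∧ decide (e.1.val % 3 = 1 ∧ e.2.val = e.1.val + 1) = b := by
  simp [incPairs]

/-- The part of the stream of `triangles n x y` that depends on `x`. -/
noncomputable def aliceStream (n : ℕ) (x : Fin k → Bool) : List (Fin n × Fin n) :=
  (incPairs n false).map (orient (aliceRev x))

/-- The part of the stream of `triangles n x y` that depends on `y`. -/
noncomputable def bobStream (n : ℕ) (y : Fin k → Bool) : List (Fin n × Fin n) :=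
  (incPairs n true).map (orient (bobRev y))

lemma isStreamOf_triangles (x y : Fin k → Bool) :
    IsStreamOf (triangles n x y) (aliceStream n x ++ bobStream n y) := by
  constructor
  · refine List.Nodup.append ?_ ?_ ?_
    · exact (Finset.nodup_toList _).map_on fun e he e' he' h =>
        orient_inj (mem_incPairs.1 he).1 (mem_incPairs.1 he').1 h
    · exact (Finset.nodup_toList _).map_on fun e he e' he' h =>
        orient_inj (mem_incPairs.1 he).1 (mem_incPairs.1 he').1 h
    · intro a ha hb
      obtain ⟨e, he, rfl⟩ := List.mem_map.1 ha
      obtain ⟨e', he', h⟩ := List.mem_map.1 hb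
      rw [mem_incPairs] at he he'
      have := orient_inj he'.1 he.1 h
      rw [this, he.2] at he'
      exact Bool.false_ne_true he'.2
  · have hA : ∀ e : Fin n × Fin n, aliceRev x e → e.1.val % 3 = 0 := by
      rintro e ⟨i, h1, -, -⟩; omega
    have hB : ∀ e : Fin n × Fin n, bobRev y e → e.1.val % 3 = 1 ∧ e.2.val = e.1.val + 1 := by
      rintro e ⟨i, h1, h2, -⟩; omega
    have key : ∀ e : Fin n × Fin n, e ∈ aliceStream n x ++ bobStream n y ↔
        ∃ e' : Fin n × Fin n, e'.1 < e'.2 ∧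
          orient (fun e => aliceRev x e ∨ bobRev y e) e' = e := by
      intro e
      rw [List.mem_append, aliceStream, bobStream, List.mem_map, List.mem_map]
      constructor
      · rintro (⟨e', he', h⟩ | ⟨e', he', h⟩)
        · rw [mem_incPairs, decide_eq_false_iff_not] at he'
          refine ⟨e', he'.1, ?_⟩
          rw [← h]
          have : ¬ bobRev y e' := fun h => he'.2 (hB e' h)
          exact orient_congr (by simp [this])
        · rw [mem_incPairs, decide_eq_true_iff] at he'
          refine ⟨e', he'.1, ?_⟩
          rw [← h]
          have : ¬ aliceRev x e' := fun h => by have := hA e' h; omega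
          exact orient_congr (by simp [this])
      · rintro ⟨e', he', h⟩
        by_cases hb : e'.1.val % 3 = 1 ∧ e'.2.val = e'.1.val + 1
        · refine Or.inr ⟨e', mem_incPairs.2 ⟨he', decide_eq_true hb⟩, ?_⟩
          rw [← h]
          have : ¬ aliceRev x e' := fun h => by have := hA e' h; omega
          exact orient_congr (by simp [this])
        · refine Or.inl ⟨e', mem_incPairs.2 ⟨he', decide_eq_false hb⟩, ?_⟩
          rw [← h]
          have : ¬ bobRev y e' := fun h => hb (hB e' h)
          exact orient_congr (by simp [this])
    rintro ⟨u, v⟩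
    rw [key]
    constructor
    · rintro ⟨⟨a, b⟩, hab, h⟩
      unfold orient at h
      split_ifs at h with hr
      · obtain ⟨rfl, rfl⟩ := Prod.mk.inj h
        exact Or.inr ⟨hab, hr⟩
      · obtain ⟨rfl, rfl⟩ := Prod.mk.inj h
        exact Or.inl ⟨hab, hr⟩
    · rintro (⟨hlt, hr⟩ | ⟨hlt, hr⟩)
      · exact ⟨(u, v), hlt, if_neg hr⟩
      · exact ⟨(v, u), hlt, if_pos hr⟩

/-- The lower bound for every problem whose outputs decide acyclicity. -/
lemma lower_bound {β : Type*} (Q : Digraph (Fin n) → β → Prop) (dec : β → Bool)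
    (hQ : ∀ G b, IsTournament G → Q G b → acyc G (dec b)) (hn : 3 ≤ n) {p : ℕ} (hp : 1 ≤ p)
    {s : ℕ} {Ω : Type*} [MeasurableSpace Ω] (μ : MeasureTheory.Measure Ω)
    [MeasureTheory.IsProbabilityMeasure μ] (A : Ω → StreamAlg (Fin n × Fin n) β s)
    (hA : RandSolves Q p μ A) : (1 / 1440 : ℝ) * (n / p) ≤ s := by
  classical
  obtain ⟨k, hk⟩ : ∃ k, k = n / 3 := ⟨_, rfl⟩
  have hkn : 3 * k ≤ n := by omega
  let X : (Fin k → Bool) → (Fin k → Bool) → Fin k → Bool → (Fin k → Bool) := fun d z i b =>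
    Function.update (aliceBits d z) i b
  let Y : (Fin k → Bool) → (Fin k → Bool) → Fin k → Bool → (Fin k → Bool) := fun d z i b =>
    Function.update (bobBits d z) i b
  have hdis : ∀ d z i j, ¬ (X d z i false j = true ∧ Y d z i false j = true) := by
    intro d z i j
    by_cases h : j = i
    · subst h; simp [X]
    · simp only [X, Y, Function.update_of_ne h, aliceBits, bobBits]
      cases d j <;> simp
  have hacyc : ∀ d z i b, acyc (triangles n (X d z i b) (Y d z i b)) (!b) := by
    intro d z i b
    cases b
    · simpa [acyc] using isAcyclic_triangles (hdis d z i)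
    · simpa [acyc] using not_isAcyclic_triangles hkn (x := X d z i true) (y := Y d z i true)
        (i := i) (by simp [X]) (by simp [Y])
  let J := Fin k × (Fin k → Bool) × Bool × (Fin k → Bool)
  let run : Ω → J → β := fun ω j => (A ω).run p
    (aliceStream n (X j.2.1 j.2.2.2 j.1 j.2.2.1) ++ bobStream n (Y j.2.1 j.2.2.2 j.1 j.2.2.1))
  obtain ⟨ω, hω⟩ := exists_card_le_of_measure_le μ
    (fun j : J => {ω | ¬ Q (triangles n (X j.2.1 j.2.2.2 j.1 j.2.2.1)
      (Y j.2.1 j.2.2.2 j.1 j.2.2.1)) (run ω j)})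
    (fun j => hA _ (isTournament_triangles _ _) _ (isStreamOf_triangles _ _))
    (fun ω => {j : J | dec (run ω j) = j.2.2.1}) (by
      intro ω j hj hq
      have hj' : dec (run ω j) = j.2.2.1 := (mem_filter.1 hj).2
      have h1 := hQ _ _ (isTournament_triangles _ _) hq
      have h2 := hacyc j.2.1 j.2.2.2 j.1 j.2.2.1
      rw [hj'] at h1
      unfold acyc at h1 h2
      rw [← h2] at h1
      revert h1
      cases j.2.2.1 <;> simp)
  obtain ⟨f, out, hf, hout⟩ := (A ω).exists_transcript hp (aliceStream (k := k) n)
    (bobStream (k := k) n) (by intro x x'; simp [aliceStream])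
  have hbound := card_le_log_of_errors f hf (fun t => dec (out t)) (by
    have h1 : ∑ i, ∑ d, (plantedErrors f (fun t => dec (out t)) d i false +
        plantedErrors f (fun t => dec (out t)) d i true) =
        #{j : J | dec (run ω j) = j.2.2.1} := by
      rw [card_filter, Fintype.sum_prod_type]
      refine sum_congr rfl fun i _ => ?_
      rw [Fintype.sum_prod_type]
      refine sum_congr rfl fun d _ => ?_
      rw [Fintype.sum_prod_type, Fintype.sum_bool, add_comm]
      simp only [plantedErrors, card_filter, hout]
      rfl
    have h2 : Fintype.card J = 2 * Fintype.card (Fin k) *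
        (2 ^ Fintype.card (Fin k) * 2 ^ Fintype.card (Fin k)) := by
      simp only [J, Fintype.card_prod, Fintype.card_fun, Fintype.card_bool, Fintype.card_fin]
      ring
    rw [h1, ← h2]
    exact hω)
  rw [Fintype.card_fun, Fintype.card_prod, Fintype.card_fin, Fintype.card_fin,
    Fintype.card_fin] at hbound
  push_cast at hbound
  rw [← pow_add, ← pow_mul, Real.log_pow] at hbound
  push_cast at hbound
  have hlog : Real.log 2 ≤ 1 := by linarith [Real.log_two_lt_d9]
  have hps : (0 : ℝ) ≤ (s + s) * p := by positivity
  have h3 : (k : ℝ) ≤ 288 * (s * p) := by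
    have := mul_le_mul_of_nonneg_left hlog hps
    nlinarith
  have h4 : (n : ℝ) ≤ 5 * k := by
    have : n ≤ 5 * k := by omega
    exact_mod_cast this
  have hp0 : (0 : ℝ) < p := by exact_mod_cast hp
  rw [← mul_div_assoc, div_le_iff₀ hp0]
  linarith

end Reduction

end TournamentStream

/-- Acyclicity of tournaments in the data stream model. Upper bound: one pass and `O(n log n)` bits
suffice, deterministically, in the model used for the lower bounds and also for one fixed program of
a random access machine. Lower bounds: `p` passes need `Ω(n / p)` bits, even for randomized
algorithms with error probability `1/3`, and the same holds for `α`-approximating the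
size of a minimum feedback arc set, with a constant that does not depend on `α`. -/
theorem mainTheorem9 :
    (∃ C : ℝ, ∀ n : ℕ, 2 ≤ n → ∃ s : ℕ, (s : ℝ) ≤ C * (n * Real.log n) ∧
      ∃ A : TournamentStream.StreamAlg (Fin n × Fin n) Bool s,
        TournamentStream.Solves TournamentStream.acyc 1 A) ∧
    (∃ (P : List TournamentStream.Instr) (C : ℝ), ∀ n : ℕ, 2 ≤ n →
      ∃ m w : ℕ, ((m * w : ℕ) : ℝ) ≤ C * (n * Real.log n) ∧
        ∀ G : Digraph (Fin n), TournamentStream.IsTournament G →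
          ∀ l, TournamentStream.IsStreamOf G l →
            (∃ b, TournamentStream.Answers P l b ∧ TournamentStream.acyc G b) ∧
            TournamentStream.WorksIn P l m w) ∧
    (∃ c : ℝ, 0 < c ∧ ∃ n₀ : ℕ, ∀ n : ℕ, n₀ ≤ n → ∀ p : ℕ, 1 ≤ p → ∀ s : ℕ,
      ∀ (Ω : Type u) [MeasurableSpace Ω] (μ : MeasureTheory.Measure Ω)
        [MeasureTheory.IsProbabilityMeasure μ]
        (A : Ω → TournamentStream.StreamAlg (Fin n × Fin n) Bool s),
        TournamentStream.RandSolves TournamentStream.acyc p μ A → c * (n / p) ≤ (s : ℝ)) ∧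
    (∃ c : ℝ, 0 < c ∧ ∃ n₀ : ℕ, ∀ n : ℕ, n₀ ≤ n → ∀ p : ℕ, 1 ≤ p → ∀ α : ℝ, 1 ≤ α → ∀ s : ℕ,
      ∀ (Ω : Type u) [MeasurableSpace Ω] (μ : MeasureTheory.Measure Ω)
        [MeasureTheory.IsProbabilityMeasure μ]
        (A : Ω → TournamentStream.StreamAlg (Fin n × Fin n) ℤ s),
        TournamentStream.RandSolves (TournamentStream.fasSizeApprox α) p μ A →
          c * (n / p) ≤ (s : ℝ)) := by
  refine ⟨TournamentStream.exists_solves_acyc, TournamentStream.exists_program_acyc,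
    ⟨1 / 1440, by norm_num, 3, ?_⟩, ⟨1 / 1440, by norm_num, 3, ?_⟩⟩
  · intro n hn p hp s Ω _ μ _ A hA
    exact TournamentStream.lower_bound TournamentStream.acyc id (fun _ _ _ h => h) hn hp μ A hA
  · intro n hn p hp α _ s Ω _ μ _ A hA
    exact TournamentStream.lower_bound (TournamentStream.fasSizeApprox α) (fun b => decide (b = 0))
      (fun _ _ hG h => h.acyc hG) hn hp μ A hA
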